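/- **Definitions.** Let $A$ be a (not necessarily unital) C*-algebra with multiplier algebra $M(A)$. The *strict topology* on $M(A)$ is the weakest topology for which the maps $x\mapsto xa$ and $x\mapsto ax$ from $M(A)$ to $A$ (with its norm topology) are continuous for all $a\in A$. A *non-degenerate Hilbert $*$-bimodule* over $A$ is a complex Hilbert space $\mathfrak H$ with a $*$-representation $\xi\mapsto a\cdot\xi$ and a $*$-anti-representation $\xi\mapsto\xi\cdot a$ of $A$ on $\mathfrak H$ that commute with each other and are both non-degenerate (the vectors $a\cdot\xi$ span a dense subspace, and so do the vectors $\xi\cdot a$); both extend uniquely to $M(A)$. A net $(\xi_i)$ in $\mathfrak H$ is *almost-$\mathfrak K_A$-central* if $\sup_{x\in L}\|x\cdot\xi_i-\xi_i\cdot x\|\to_i 0$ for every strictly compact subset $L\subseteq M(A)$. A vector $\xi$ is *central* if $a\cdot\xi=\xi\cdot a$ for all $a\in A$. The C*-algebra $A$ has *strong Property $(T)$* if for every non-degenerate Hilbert $*$-bimodule $\mathfrak H$ over $A$ and every almost-$\mathfrak K_A$-central net $(\xi_i)$ of unit vectors in $\mathfrak H$ one has $\|\xi_i-P\xi_i\|\to_i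 0$, where $P$ is the orthogonal projection of $\mathfrak H$ onto the closed subspace of central vectors. The C*-algebra $A$ is *nuclear* if for every C*-algebra $B$ the algebraic tensor product $A\odot B$ has only one C*-norm. For a locally compact (Hausdorff) group $G$ with Haar measure $\mu$, the *reduced group C*-algebra* $C^*_r(G)$ is the C*-algebra of operators on $L^2(G,\mu)$ generated by the left convolution operators $\lambda(f)$, $f\in C_c(G)$ (equivalently $f\in L^1(G,\mu)$). The group $G$ is *amenable* if there is a left invariant mean on the bounded continuous functions on $G$. **Theorem 1.3.** Let $G$ be a locally compact group such that $C^*_r(G)$ is nuclear. If $G$ is non-amenable, then $C^*_r(G)$ has strong Property $(T)$; in fact, no non-degenerate Hilbert $*$-bimodule over $C^*_r(G)$ has an almost-$\mathfrak K_{C^*_r(G)}$-central net of unit vectors. -/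

import Mathlib

open MeasureTheory Filter Topology MulOpposite
open scoped TensorProduct MultiplierAlgebra CompactlySupported BoundedContinuousFunction

universe u v w

/-! ### Amenable groups -/

/-- Left translation of a bounded continuous function: `t ↦ f (s * t)`. -/
def leftTranslate {G : Type u} [Group G] [TopologicalSpace G] [IsTopologicalGroup G]
    (s : G) (f : G →ᵇ ℝ) : G →ᵇ ℝ :=
  f.compContinuous ⟨fun t => s * t, continuous_const_mul s⟩

/-- A topological group is amenable if the bounded continuous functions on it carry a left
invariant mean: a positive linear functional `m` with `m 1 = 1` that is invariant under left
translations. (For locally compact groups this is one of the standard equivalent definitions.) -/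
def IsAmenableGroup (G : Type u) [Group G] [TopologicalSpace G] [IsTopologicalGroup G] : Prop :=
  ∃ m : (G →ᵇ ℝ) →ₗ[ℝ] ℝ,
    m (BoundedContinuousFunction.const G 1) = 1 ∧
    (∀ f : G →ᵇ ℝ, (∀ t, 0 ≤ f t) → 0 ≤ m f) ∧
    ∀ (s : G) (f : G →ᵇ ℝ), m (leftTranslate s f) = m f

/-! ### The reduced group C*-algebra -/

section ReducedGroupCStarAlgebra

set_option linter.unusedSectionVars false

variable {G : Type u} [Group G] [TopologicalSpace G] [IsTopologicalGroup G]
  [LocallyCompactSpace G] [T2Space G] [MeasurableSpace G] [BorelSpace G]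
  (μ : Measure G) [μ.IsHaarMeasure] [μ.Regular]

/-- The left regular representation of `G` on `L²(G, μ)`: `(λ(s) ξ)(t) = ξ(s⁻¹ t)`. -/
noncomputable def leftRegular (s : G) (ξ : Lp ℂ 2 μ) : Lp ℂ 2 μ :=
  DomMulAct.mk s⁻¹ • ξ

theorem leftRegular_ae (s : G) (ξ : Lp ℂ 2 μ) :
    leftRegular μ s ξ =ᵐ[μ] fun t => ξ (s⁻¹ * t) :=
  DomMulAct.smul_Lp_ae_eq _ ξ

theorem norm_leftRegular (s : G) (ξ : Lp ℂ 2 μ) : ‖leftRegular μ s ξ‖ = ‖ξ‖ :=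
  DomMulAct.norm_smul_Lp _ ξ

theorem continuous_leftRegular (ξ : Lp ℂ 2 μ) : Continuous fun s : G => leftRegular μ s ξ := by
  have : Fact ((2 : ENNReal) ≠ ⊤) := ⟨by norm_num⟩
  unfold leftRegular
  exact ((DomMulAct.continuous_mk (M := G)).comp continuous_inv).smul continuous_const

theorem integrable_smul_leftRegular (f : C_c(G, ℂ)) (ξ : Lp ℂ 2 μ) :
    Integrable (fun s => f s • leftRegular μ s ξ) μ :=
  (f.continuous.smul (continuous_leftRegular μ ξ)).integrable_of_hasCompactSupport
    f.hasCompactSupport.smul_right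

/-- The integrated form of the left regular representation on `C_c(G)`:
`λ(f) ξ = ∫ f(s) λ(s) ξ dμ(s)`, that is, convolution by `f` on `L²(G, μ)`. -/
noncomputable def regularRep (f : C_c(G, ℂ)) : Lp ℂ 2 μ →L[ℂ] Lp ℂ 2 μ :=
  LinearMap.mkContinuous
    { toFun := fun ξ => ∫ s, f s • leftRegular μ s ξ ∂μ
      map_add' := fun ξ η => by
        rw [← integral_add (integrable_smul_leftRegular μ f ξ)
          (integrable_smul_leftRegular μ f η)]
        simp only [leftRegular, smul_add]
      map_smul' := fun c ξ => by
        rw [RingHom.id_apply, ← integral_smul]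
        refine integral_congr_ae (Eventually.of_forall fun s => ?_)
        simp only [leftRegular]
        rw [smul_comm (DomMulAct.mk s⁻¹) c ξ, smul_comm] }
    (∫ s, ‖f s‖ ∂μ)
    fun ξ => by
      refine (norm_integral_le_integral_norm _).trans (le_of_eq ?_)
      rw [← integral_mul_const]
      simp only [norm_smul, norm_leftRegular]

theorem regularRep_apply (f : C_c(G, ℂ)) (ξ : Lp ℂ 2 μ) :
    regularRep μ f ξ = ∫ s, f s • leftRegular μ s ξ ∂μ := rfl

/-- The reduced group C*-algebra of `G`: the C*-algebra of operators on `L²(G, μ)` generated by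
the operators `λ(f)`, where `f` runs through `C_c(G)` (equivalently, through `L¹(G, μ)`, as
`C_c(G)` is dense there and `λ` is contractive on `L¹(G, μ)`). -/
noncomputable def reducedGroupCStarAlgebra :
    NonUnitalStarSubalgebra ℂ (Lp ℂ 2 μ →L[ℂ] Lp ℂ 2 μ) :=
  (NonUnitalStarAlgebra.adjoin ℂ (Set.range (regularRep μ))).topologicalClosure

noncomputable instance : NonUnitalCStarAlgebra (reducedGroupCStarAlgebra μ) :=
  NonUnitalStarSubalgebra.nonUnitalCStarAlgebra _
    (h_closed := NonUnitalStarSubalgebra.isClosed_topologicalClosure _)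

end ReducedGroupCStarAlgebra

/-! ### Nuclear C*-algebras -/

/-- `N` is a C*-norm on the algebraic tensor product `A ⊗ B`, whose product and involution are
given by `(a ⊗ b) (a' ⊗ b') = a a' ⊗ b b'` and `(a ⊗ b)* = a* ⊗ b*`. -/
structure IsCStarNorm {A : Type u} {B : Type v} [NonUnitalCStarAlgebra A]
    [NonUnitalCStarAlgebra B] (N : Seminorm ℂ (A ⊗[ℂ] B)) : Prop where
  eq_zero : ∀ x, N x = 0 → x = 0
  mul_le : ∀ x y, N (x * y) ≤ N x * N y
  star_mul_self : ∀ x, N (star x * x) = N x ^ 2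

/-- A C*-algebra `A` is nuclear if for every C*-algebra `B` there is at most one C*-norm on the
algebraic tensor product `A ⊗ B` (so that the maximal and the minimal one coincide). -/
def IsNuclear (A : Type u) [NonUnitalCStarAlgebra A] : Prop :=
  ∀ (B : Type u) [NonUnitalCStarAlgebra B] (N₁ N₂ : Seminorm ℂ (A ⊗[ℂ] B)),
    IsCStarNorm N₁ → IsCStarNorm N₂ → N₁ = N₂

/-! ### The strict topology -/

theorem fst_mul_eq {A : Type u} [NonUnitalCStarAlgebra A] (x : 𝓜(ℂ, A)) (a b : A) :
    x.fst (a * b) = x.fst a * b := by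
  refine sub_eq_zero.mp ((CStarRing.star_mul_self_eq_zero_iff _).mp ?_)
  rw [mul_sub, ← mul_assoc, ← x.central, ← x.central, mul_assoc, sub_self]

theorem snd_mul_eq {A : Type u} [NonUnitalCStarAlgebra A] (x : 𝓜(ℂ, A)) (a b : A) :
    x.snd (a * b) = a * x.snd b := by
  refine sub_eq_zero.mp ((CStarRing.mul_star_self_eq_zero_iff _).mp ?_)
  rw [sub_mul, mul_assoc a, x.central, x.central, mul_assoc, sub_self]

/-- The strict topology on the multiplier algebra `M(A)`: the weakest topology for which the maps
`x ↦ x a` and `x ↦ a x` from `M(A)` to `A` are continuous for all `a : A`. A multiplier `x` is a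
double centralizer, with `x.fst a = x a` and `x.snd a = a x`. -/
@[reducible]
noncomputable def strictTopology (A : Type u) [NonUnitalCStarAlgebra A] :
    TopologicalSpace 𝓜(ℂ, A) :=
  ⨅ a : A, TopologicalSpace.induced (fun x => x.fst a) (inferInstance : TopologicalSpace A) ⊓
    TopologicalSpace.induced (fun x => x.snd a) (inferInstance : TopologicalSpace A)

/-! ### Hilbert *-bimodules -/

/-- A Hilbert *-bimodule structure over `A` on the Hilbert space `H`: a *-representation
`a · ξ = left a ξ` of `A` and a *-anti-representation `ξ · a = right (op a) ξ` of `A` on `H` that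
commute with each other. -/
structure HilbertStarBimodule (A : Type u) [NonUnitalCStarAlgebra A] (H : Type v)
    [NormedAddCommGroup H] [InnerProductSpace ℂ H] [CompleteSpace H] where
  left : A →⋆ₙₐ[ℂ] (H →L[ℂ] H)
  right : Aᵐᵒᵖ →⋆ₙₐ[ℂ] (H →L[ℂ] H)
  left_right_comm : ∀ (a b : A) (ξ : H), left a (right (op b) ξ) = right (op b) (left a ξ)

namespace HilbertStarBimodule

variable {A : Type u} [NonUnitalCStarAlgebra A] {H : Type v}
  [NormedAddCommGroup H] [InnerProductSpace ℂ H] [CompleteSpace H]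

/-- Both actions are non-degenerate: the vectors `a · ξ` span a dense subspace of `H`, and so do
the vectors `ξ · a`. -/
structure IsNondegenerate (M : HilbertStarBimodule A H) : Prop where
  left_dense : Dense (Submodule.span ℂ {η : H | ∃ (a : A) (ξ : H), η = M.left a ξ} : Set H)
  right_dense :
    Dense (Submodule.span ℂ {η : H | ∃ (a : A) (ξ : H), η = M.right (op a) ξ} : Set H)

/-- The linear map `A ⊗ H → H`, `a ⊗ ξ ↦ σ a ξ`. -/
noncomputable def actionMap (σ : A →ₗ[ℂ] (H →L[ℂ] H)) : A ⊗[ℂ] H →ₗ[ℂ] H :=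
  TensorProduct.lift (ContinuousLinearMap.coeLM ℂ ∘ₗ σ)

/-- The operator on `H` given by `σ a ξ ↦ σ (T a) ξ`, extended by continuity. -/
noncomputable def extendAction (σ : A →ₗ[ℂ] (H →L[ℂ] H)) (T : A →ₗ[ℂ] A) : H →L[ℂ] H :=
  (actionMap (σ ∘ₗ T)).extendOfNorm (actionMap σ)

theorem extendAction_apply (σ : A →ₗ[ℂ] (H →L[ℂ] H)) (T : A →ₗ[ℂ] A)
    (hσ : Dense (Submodule.span ℂ {η : H | ∃ (a : A) (ξ : H), η = σ a ξ} : Set H))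
    (l : Filter A) [l.NeBot] (C : ℝ) (hC : ∀ᶠ e in l, ‖σ (T e)‖ ≤ C)
    (hl : ∀ a, Tendsto (fun e => σ (T e) * σ a) l (𝓝 (σ (T a)))) (a : A) (ξ : H) :
    extendAction σ T (σ a ξ) = σ (T a) ξ := by
  have key : ∀ z : A ⊗[ℂ] H,
      Tendsto (fun e => σ (T e) (actionMap σ z)) l (𝓝 (actionMap (σ ∘ₗ T) z)) := by
    intro z
    induction z with
    | zero => simp
    | tmul a ξ =>
      simpa [actionMap] using! ((ContinuousLinearMap.apply ℂ H ξ).continuous.tendsto _).comp (hl a)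
    | add x y hx hy => simpa using hx.add hy
  have hdense : DenseRange (actionMap σ) := by
    refine hσ.mono ?_
    rw [← LinearMap.coe_range, SetLike.coe_subset_coe, Submodule.span_le]
    rintro _ ⟨a, ξ, rfl⟩
    exact ⟨a ⊗ₜ ξ, by simp [actionMap]⟩
  have hbound : ∃ C, ∀ z, ‖actionMap (σ ∘ₗ T) z‖ ≤ C * ‖actionMap σ z‖ := by
    refine ⟨C, fun z => le_of_tendsto (key z).norm ?_⟩
    filter_upwards [hC] with e he
    exact (ContinuousLinearMap.le_opNorm _ _).trans
      (mul_le_mul_of_nonneg_right he (norm_nonneg _))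
  have := LinearMap.extendOfNorm_eq hdense hbound (a ⊗ₜ[ℂ] ξ)
  simpa [actionMap] using! this

variable (M : HilbertStarBimodule A H)

/-- The left action of `A` as a linear map. -/
noncomputable def leftLin : A →ₗ[ℂ] (H →L[ℂ] H) :=
  { toFun := fun a => M.left a
    map_add' := fun a b => map_add _ a b
    map_smul' := fun c a => map_smul _ c a }

/-- The right action of `A` as a linear map. -/
noncomputable def rightLin : A →ₗ[ℂ] (H →L[ℂ] H) :=
  { toFun := fun a => M.right (op a)
    map_add' := fun a b => by rw [op_add, map_add]
    map_smul' := fun c a => by rw [op_smul, map_smul]; rfl }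

/-- The left action `ξ ↦ x · ξ` of a multiplier `x`, the unique continuous extension of
`a · ξ ↦ (x a) · ξ` (for non-degenerate bimodules, see `leftMul_apply`). -/
noncomputable def leftMul (x : 𝓜(ℂ, A)) : H →L[ℂ] H :=
  extendAction M.leftLin x.fst

/-- The right action `ξ ↦ ξ · x` of a multiplier `x`, the unique continuous extension of
`ξ · a ↦ ξ · (a x)` (for non-degenerate bimodules, see `rightMul_apply`). -/
noncomputable def rightMul (x : 𝓜(ℂ, A)) : H →L[ℂ] H :=
  extendAction M.rightLin x.snd

theorem leftMul_apply (hM : M.IsNondegenerate) (x : 𝓜(ℂ, A)) (a : A) (ξ : H) :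
    M.leftMul x (M.left a ξ) = M.left (x.fst a) ξ := by
  let _ := CStarAlgebra.spectralOrder A
  have _ := CStarAlgebra.spectralOrderedRing A
  have hau := CStarAlgebra.increasingApproximateUnit A
  refine extendAction_apply M.leftLin x.fst hM.left_dense (CStarAlgebra.approximateUnit A) ‖x.fst‖
    ?_ (fun b => ?_) a ξ
  · filter_upwards [hau.eventually_norm] with e he
    refine (NonUnitalStarAlgHom.norm_apply_le M.left (x.fst e)).trans ?_
    simpa using x.fst.le_of_opNorm_le_of_le le_rfl he
  · have h : ∀ e, M.leftLin (x.fst e) * M.leftLin b = M.left (x.fst (e * b)) := fun e => by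
      rw [fst_mul_eq, map_mul]
      rfl
    have hc : Continuous fun c => M.left (x.fst c) :=
      (AddMonoidHomClass.continuous_of_bound M.left 1 fun c => by
        simpa using NonUnitalStarAlgHom.norm_apply_le M.left c).comp x.fst.continuous
    exact ((hc.tendsto b).comp (hau.tendsto_mul_right b)).congr fun e => (h e).symm

theorem rightMul_apply (hM : M.IsNondegenerate) (x : 𝓜(ℂ, A)) (a : A) (ξ : H) :
    M.rightMul x (M.right (op a) ξ) = M.right (op (x.snd a)) ξ := by
  let _ := CStarAlgebra.spectralOrder A
  have _ := CStarAlgebra.spectralOrderedRing A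
  have hau := CStarAlgebra.increasingApproximateUnit A
  refine extendAction_apply M.rightLin x.snd hM.right_dense (CStarAlgebra.approximateUnit A)
    ‖x.snd‖ ?_ (fun b => ?_) a ξ
  · filter_upwards [hau.eventually_norm] with e he
    refine (NonUnitalStarAlgHom.norm_apply_le M.right (op (x.snd e))).trans ?_
    rw [norm_op]
    simpa using x.snd.le_of_opNorm_le_of_le le_rfl he
  · have h : ∀ e, M.rightLin (x.snd e) * M.rightLin b = M.right (op (x.snd (b * e))) := fun e => by
      rw [snd_mul_eq, op_mul, map_mul]
      rfl
    have hc : Continuous fun c => M.right (op (x.snd c)) :=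
      (AddMonoidHomClass.continuous_of_bound M.right 1 fun c => by
        simpa using NonUnitalStarAlgHom.norm_apply_le M.right c).comp
        (continuous_op.comp x.snd.continuous)
    exact ((hc.tendsto b).comp (hau.tendsto_mul_left b)).congr fun e => (h e).symm

/-- A family `(ξ i)` indexed by a directed set is almost-`𝔎_A`-central if
`sup_{x ∈ L} ‖x · ξ i - ξ i · x‖ → 0` for every strictly compact subset `L` of `M(A)`. -/
def IsAlmostCentral {ι : Type w} [Preorder ι] (ξ : ι → H) : Prop :=
  ∀ L : Set 𝓜(ℂ, A), @IsCompact _ (strictTopology A) L →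
    ∀ ε : ℝ, 0 < ε → ∀ᶠ i in atTop, ∀ x ∈ L, ‖M.leftMul x (ξ i) - M.rightMul x (ξ i)‖ ≤ ε

/-- The space of central vectors: all `ξ` with `a · ξ = ξ · a` for every `a : A`. -/
def centralVectors : Submodule ℂ H where
  carrier := {ξ | ∀ a : A, M.left a ξ = M.right (op a) ξ}
  add_mem' := fun hξ hη a => by rw [map_add, map_add, hξ a, hη a]
  zero_mem' := fun a => by rw [map_zero, map_zero]
  smul_mem' := fun c ξ hξ a => by rw [map_smul, map_smul, hξ a]

theorem isClosed_centralVectors : IsClosed (M.centralVectors : Set H) := by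
  have : (M.centralVectors : Set H) = ⋂ a : A, {ξ | M.left a ξ = M.right (op a) ξ} := by
    ext ξ
    simp [centralVectors]
  rw [this]
  exact isClosed_iInter fun a =>
    isClosed_eq (M.left a).continuous (M.right (op a)).continuous

instance : CompleteSpace M.centralVectors := M.isClosed_centralVectors.completeSpace_coe

end HilbertStarBimodule

/-! ### Strong Property (T) -/

/-- A C*-algebra `A` has strong Property (T) if, for every non-degenerate Hilbert *-bimodule over
`A` and every almost-`𝔎_A`-central net `(ξ i)` of unit vectors in it, `‖ξ i - P (ξ i)‖ → 0`, where
`P` is the orthogonal projection onto the space of central vectors. -/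
def HasStrongPropertyT (A : Type u) [NonUnitalCStarAlgebra A] : Prop :=
  ∀ (H : Type v) [NormedAddCommGroup H] [InnerProductSpace ℂ H] [CompleteSpace H]
    (M : HilbertStarBimodule A H), M.IsNondegenerate →
    ∀ (ι : Type w) [Preorder ι] [IsDirectedOrder ι] [Nonempty ι] (ξ : ι → H),
      (∀ i, ‖ξ i‖ = 1) → M.IsAlmostCentral ξ →
        Tendsto (fun i => ‖ξ i - M.centralVectors.starProjection (ξ i)‖) atTop (𝓝 0)

/-! ### Contractive unital functionals -/

section States

variable {K : Type*} [NormedAddCommGroup K] [InnerProductSpace ℂ K] [CompleteSpace K]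

/-! An almost central net `ξ i` of unit vectors in a non-degenerate bimodule over the nuclear
algebra A = C*_r(G) forces G to be amenable. For non-amenable G there is therefore no such net, and
strong Property (T) holds vacuously.

Put E = L²(G, μ) and let K be the Hilbert tensor product of E with its dual. Operators a on E and
transposes of operators b on E give commuting representations of A and its opposite on K, and their
product is faithful on the algebraic tensor product (`injective_of_apply_tmul_eq_tensorOp`). The two
actions on the bimodule give another commuting pair. The maximum of the two resulting seminorms is
again a C*-norm, so nuclearity makes the norm on K dominate the one coming from the bimodule
(`IsNuclear.norm_pairMap_le`). Hence the vector functional of a unit vector ξ extends by Hahn–Banach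
to a contractive functional φ on B(K), and an approximate unit shows φ 1 = 1
(`HilbertStarBimodule.exists_state`).

Translations λ(s) are unitary multipliers of A. Almost centrality, used only on singletons, makes
λ(s) · ξ · λ(s)* close to ξ, so φ is almost 1 at the unitary u given by λ(s) on E and the transpose
of λ(s)* on the dual. Cauchy–Schwarz then makes φ almost invariant under conjugation by u
(`abs_re_conj_sub_le`). On the first tensor leg this is conjugation by λ(s), which translates
multiplication operators. Restricting to bounded continuous functions and passing to an ultrafilter
limit gives an invariant mean (`isAmenableGroup_of_tendsto`). -/

theorem norm_one_sub_two_smul_star_mul_self_le {e : K →L[ℂ] K} (he : ‖e‖ ≤ 1) :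
    ‖1 - (2 : ℂ) • (star e * e)‖ ≤ 1 := by
  have h1 : ∀ v, ‖(star e * e) v‖ ≤ ‖e v‖ := fun v => by
    refine ((star e).le_of_opNorm_le (c := 1) (by rwa [norm_star]) (e v)).trans ?_
    rw [one_mul]
  have h2 : ∀ v, RCLike.re (inner ℂ v ((star e * e) v)) = ‖e v‖ ^ 2 := fun v => by
    have : inner ℂ v ((star e * e) v) = inner ℂ (e v) (e v) :=
      ContinuousLinearMap.adjoint_inner_right e v (e v)
    rw [this, inner_self_eq_norm_sq]
  generalize star e * e = p at h1 h2 ⊢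
  refine ContinuousLinearMap.opNorm_le_bound _ zero_le_one fun v => ?_
  rw [one_mul]
  refine le_of_sq_le_sq ?_ (norm_nonneg _)
  -- With p = e*e the cross term is 4‖e v‖², which absorbs 4‖p v‖² because ‖p v‖ ≤ ‖e v‖.
  have h3 : ‖v - (2 : ℂ) • p v‖ ^ 2 = ‖v‖ ^ 2 - 4 * ‖e v‖ ^ 2 + 4 * ‖p v‖ ^ 2 := by
    have h4 : RCLike.re (inner ℂ v ((2 : ℂ) • p v)) = 2 * ‖e v‖ ^ 2 := by
      rw [inner_smul_right, ← h2 v, show (2 : ℂ) = ((2 : ℝ) : ℂ) by norm_num]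
      exact Complex.re_ofReal_mul _ _
    rw [norm_sub_sq (𝕜 := ℂ), h4, norm_smul, Complex.norm_ofNat]
    ring
  have h5 := pow_le_pow_left₀ (norm_nonneg _) (h1 v) 2
  change ‖v - (2 : ℂ) • p v‖ ^ 2 ≤ ‖v‖ ^ 2
  linarith

variable (φ : StrongDual ℂ (K →L[ℂ] K))

/-- The real part of `φ (x* x)`. -/
noncomputable def sqForm (x : K →L[ℂ] K) : ℝ := (φ (star x * x)).re

variable {φ}

theorem sqForm_le (hφ : ‖φ‖ ≤ 1) (x : K →L[ℂ] K) : sqForm φ x ≤ ‖x‖ ^ 2 := by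
  refine (Complex.re_le_norm _).trans ((φ.le_of_opNorm_le hφ _).trans ?_)
  rw [one_mul, CStarRing.norm_star_mul_self, sq]

/-- After scaling x to a contraction e, |φ(1 - 2 e*e)| ≤ 1 and φ 1 = 1 give 1 - 2 Re φ(e*e) ≤ 1.
Positivity thus follows from contractivity and unitality alone. -/
theorem sqForm_nonneg (hφ : ‖φ‖ ≤ 1) (h1 : φ 1 = 1) (x : K →L[ℂ] K) : 0 ≤ sqForm φ x := by
  rcases eq_or_ne x 0 with rfl | hx
  · simp [sqForm]
  have hx' : 0 < ‖x‖ := norm_pos_iff.mpr hx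
  set e : K →L[ℂ] K := ((‖x‖⁻¹ : ℝ) : ℂ) • x with he
  have hen : ‖e‖ ≤ 1 := by
    rw [he, norm_smul, Complex.norm_real, norm_inv, norm_norm, inv_mul_cancel₀ hx'.ne']
  have h2 := (φ.le_of_opNorm_le hφ _).trans
    ((one_mul _).trans_le (norm_one_sub_two_smul_star_mul_self_le hen))
  have h3 : star e * e = ((‖x‖⁻¹ ^ 2 : ℝ) : ℂ) • (star x * x) := by
    rw [he, star_smul, smul_mul_smul_comm, Complex.star_def, Complex.conj_ofReal]
    push_cast
    rw [sq]
  rw [map_sub, h1, map_smul, h3, map_smul] at h2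
  have h4 := (Complex.re_le_norm _).trans h2
  have h5 : (1 - (2 : ℂ) • (((‖x‖⁻¹ ^ 2 : ℝ) : ℂ) • φ (star x * x))).re =
      1 - 2 * (‖x‖⁻¹ ^ 2 * sqForm φ x) := by
    simp only [smul_eq_mul, Complex.sub_re, Complex.one_re, sqForm]
    rw [show (2 : ℂ) = ((2 : ℝ) : ℂ) by norm_num, Complex.re_ofReal_mul, Complex.re_ofReal_mul]
  rw [h5] at h4
  have h6 : 0 ≤ ‖x‖⁻¹ ^ 2 * sqForm φ x := by linarith
  exact nonneg_of_mul_nonneg_right h6 (by positivity)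

theorem sqForm_add (x y : K →L[ℂ] K) :
    sqForm φ (x + y) = sqForm φ x + (φ (star x * y + star y * x)).re + sqForm φ y := by
  simp only [sqForm, star_add, add_mul, mul_add, map_add, Complex.add_re]
  ring

theorem sqForm_real_smul (t : ℝ) (x : K →L[ℂ] K) :
    sqForm φ ((t : ℂ) • x) = t * t * sqForm φ x := by
  rw [sqForm, star_smul, smul_mul_smul_comm, Complex.star_def, Complex.conj_ofReal,
    ← Complex.ofReal_mul, map_smul, smul_eq_mul, Complex.re_ofReal_mul, sqForm]

/-- Cauchy–Schwarz: the real quadratic polynomial t ↦ `sqForm φ (x + t y)` is nonnegative, so its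
discriminant is at most 0. -/
theorem sq_re_le_sqForm_mul (hφ : ‖φ‖ ≤ 1) (h1 : φ 1 = 1) (x y : K →L[ℂ] K) :
    (φ (star x * y + star y * x)).re ^ 2 ≤ 4 * sqForm φ x * sqForm φ y := by
  have h := discrim_le_zero (a := sqForm φ y) (b := (φ (star x * y + star y * x)).re)
    (c := sqForm φ x) fun t => by
      have := sqForm_nonneg hφ h1 (x + (t : ℂ) • y)
      rw [sqForm_add, sqForm_real_smul, star_smul, mul_smul_comm, smul_mul_assoc,
        Complex.star_def, Complex.conj_ofReal, ← smul_add, map_smul, smul_eq_mul,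
        Complex.re_ofReal_mul] at this
      linarith
  rw [discrim] at h
  linarith

theorem sqForm_add_le (hφ : ‖φ‖ ≤ 1) (h1 : φ 1 = 1) (x y : K →L[ℂ] K) :
    sqForm φ (x + y) ≤ 2 * sqForm φ x + 2 * sqForm φ y := by
  have h := sqForm_nonneg hφ h1 (x + ((-1 : ℝ) : ℂ) • y)
  rw [sqForm_add, sqForm_real_smul] at h
  rw [sqForm_add]
  have : star x * (((-1 : ℝ) : ℂ) • y) + star (((-1 : ℝ) : ℂ) • y) * x =
      -(star x * y + star y * x) := by
    simp
    abel
  rw [this, map_neg, Complex.neg_re] at h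
  linarith

theorem sqForm_mul_of_star_mul_self {u : K →L[ℂ] K} (hu : star u * u = 1) (x : K →L[ℂ] K) :
    sqForm φ (u * x) = sqForm φ x := by
  rw [sqForm, star_mul, mul_assoc, ← mul_assoc (star u), hu, one_mul, sqForm]

/-- Write u - 1 = (u e - e) + (u (1 - e) - (1 - e)). Since u is an isometry, both pieces of the
second bracket have the same form value as 1 - e, and applying `sqForm_add_le` twice gives 2 · (2 +
2) = 8. The point is to control φ at u when φ is known explicitly only on a subalgebra containing e
and u e. -/
theorem sqForm_sub_one_le (hφ : ‖φ‖ ≤ 1) (h1 : φ 1 = 1) {u : K →L[ℂ] K} (hu : star u * u = 1)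
    (e : K →L[ℂ] K) :
    sqForm φ (u - 1) ≤ 2 * sqForm φ (u * e - e) + 8 * sqForm φ (1 - e) := by
  have h2 := sqForm_add_le hφ h1 (u * e - e) ((u * (1 - e)) + ((-1 : ℝ) : ℂ) • (1 - e))
  have h3 := sqForm_add_le hφ h1 (u * (1 - e)) (((-1 : ℝ) : ℂ) • (1 - e))
  rw [sqForm_mul_of_star_mul_self hu, sqForm_real_smul] at h3
  have h4 : u * e - e + (u * (1 - e) + ((-1 : ℝ) : ℂ) • (1 - e)) = u - 1 := by
    simp only [mul_sub, mul_one, Complex.ofReal_neg, Complex.ofReal_one, neg_smul, one_smul]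
    abel
  rw [h4] at h2
  linarith

/-- A unital contractive functional is almost invariant under conjugation by a unitary `u` if it is
almost `1` at `u`. -/
theorem abs_re_conj_sub_le (hφ : ‖φ‖ ≤ 1) (h1 : φ 1 = 1) {u m : K →L[ℂ] K} {C : ℝ}
    (hu : ‖u‖ ≤ 1) (hm : star m = m) (hC : ‖m‖ ≤ C) :
    |(φ (star u * m * u)).re - (φ m).re| ≤ 2 * C * √(sqForm φ (u - 1)) := by
  have hC0 : 0 ≤ C := (norm_nonneg _).trans hC
  have hQ := sqForm_nonneg hφ h1 (u - 1)
  have key := sq_re_le_sqForm_mul hφ h1 (m * (u + 1)) (u - 1)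
  have hx : sqForm φ (m * (u + 1)) ≤ (2 * C) ^ 2 := by
    refine (sqForm_le hφ _).trans (pow_le_pow_left₀ (norm_nonneg _) ?_ 2)
    have h1' : ‖(1 : K →L[ℂ] K)‖ ≤ 1 := ContinuousLinearMap.norm_id_le
    calc ‖m * (u + 1)‖ ≤ ‖m‖ * ‖u + 1‖ := norm_mul_le _ _
      _ ≤ C * 2 := by
        refine mul_le_mul hC ((norm_add_le _ _).trans (by linarith)) (norm_nonneg _) hC0
      _ = 2 * C := mul_comm _ _
  -- Polarisation: the mixed terms cancel as m is self-adjoint, so Cauchy–Schwarz for m (u + 1) and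
  -- u - 1 bounds exactly the conjugation defect.
  have e1 : star (m * (u + 1)) * (u - 1) + star (u - 1) * (m * (u + 1)) =
      (2 : ℂ) • (star u * m * u - m) := by
    simp only [star_mul, star_add, star_sub, star_one, hm, mul_add, add_mul, mul_sub, sub_mul,
      mul_one, one_mul, two_smul, ← mul_assoc]
    abel
  have e2 : (φ (star (m * (u + 1)) * (u - 1) + star (u - 1) * (m * (u + 1)))).re =
      2 * ((φ (star u * m * u)).re - (φ m).re) := by
    rw [e1, map_smul, map_sub, smul_eq_mul, show (2 : ℂ) = ((2 : ℝ) : ℂ) by norm_num,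
      Complex.re_ofReal_mul, Complex.sub_re]
  rw [e2] at key
  refine abs_le_of_sq_le_sq ?_ (by positivity)
  rw [mul_pow, Real.sq_sqrt hQ]
  nlinarith [mul_le_mul_of_nonneg_right hx hQ]

end States

/-- Hahn–Banach for a functional given on a vector space that is mapped into a normed space. -/
theorem exists_strongDual_of_norm_le {V X : Type*} [AddCommGroup V] [Module ℂ V]
    [NormedAddCommGroup X] [NormedSpace ℂ X] (Λ : V →ₗ[ℂ] X) (f : V →ₗ[ℂ] ℂ)
    (h : ∀ v, ‖f v‖ ≤ ‖Λ v‖) : ∃ φ : StrongDual ℂ X, ‖φ‖ ≤ 1 ∧ ∀ v, φ (Λ v) = f v := by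
  -- A linear section of `Λ` over its range carries `f` to a contractive functional there.
  obtain ⟨s, hs⟩ := Λ.rangeRestrict.exists_rightInverse_of_surjective
    (LinearMap.range_eq_top.mpr Λ.surjective_rangeRestrict)
  have hs' : ∀ y : Λ.range, Λ (s y) = y := fun y =>
    congrArg Subtype.val (LinearMap.congr_fun hs y)
  have hb : ∀ y : Λ.range, ‖(f ∘ₗ s) y‖ ≤ 1 * ‖y‖ := fun y => by
    have := h (s y)
    rw [hs'] at this
    rwa [one_mul]
  obtain ⟨φ, hφ, hn⟩ := exists_extension_norm_eq Λ.range ((f ∘ₗ s).mkContinuous 1 hb)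
  refine ⟨φ, hn.trans_le (LinearMap.mkContinuous_norm_le _ zero_le_one hb), fun v => ?_⟩
  have h2 := hφ ⟨Λ v, LinearMap.mem_range_self Λ v⟩
  rw [LinearMap.mkContinuous_apply] at h2
  -- The choice of section is harmless: `f` vanishes on the kernel of `Λ` by the bound `h`.
  refine h2.trans (sub_eq_zero.mp (norm_le_zero_iff.mp ?_))
  have := h (s ⟨Λ v, LinearMap.mem_range_self Λ v⟩ - v)
  rw [map_sub, map_sub, hs', sub_self, norm_zero] at this
  exact this

/-! ### Products of commuting representations -/

section PairMap

variable {A : Type u} {B : Type v} [NonUnitalCStarAlgebra A] [NonUnitalCStarAlgebra B]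
  {C : Type w} [CStarAlgebra C]

/-- The linear map `a ⊗ b ↦ π a * σ b`. -/
noncomputable def pairMap (π : A →⋆ₙₐ[ℂ] C) (σ : B →⋆ₙₐ[ℂ] C) : A ⊗[ℂ] B →ₗ[ℂ] C :=
  TensorProduct.lift ((LinearMap.mul ℂ C).compl₁₂ (π : A →ₗ[ℂ] C) (σ : B →ₗ[ℂ] C))

variable (π : A →⋆ₙₐ[ℂ] C) (σ : B →⋆ₙₐ[ℂ] C)

@[simp]
theorem pairMap_tmul (a : A) (b : B) : pairMap π σ (a ⊗ₜ b) = π a * σ b := by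
  simp [pairMap]

variable {π σ}

theorem pairMap_mul (h : ∀ a b, π a * σ b = σ b * π a)
    (x y : A ⊗[ℂ] B) :
    pairMap π σ (x * y) = pairMap π σ x * pairMap π σ y := by
  induction x with
  | zero => simp
  | add x x' hx hx' => rw [add_mul, map_add, map_add, add_mul, hx, hx']
  | tmul a b =>
    induction y with
    | zero => simp
    | add y y' hy hy' => rw [mul_add, map_add, map_add, mul_add, hy, hy']
    | tmul a' b' =>
      rw [Algebra.TensorProduct.tmul_mul_tmul, pairMap_tmul, pairMap_tmul, pairMap_tmul, map_mul,
        map_mul, mul_assoc, mul_assoc, ← mul_assoc (σ b), ← h, mul_assoc]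

theorem pairMap_star (h : ∀ a b, π a * σ b = σ b * π a)
    (x : A ⊗[ℂ] B) :
    pairMap π σ (star x) = star (pairMap π σ x) := by
  induction x with
  | zero => simp
  | add x x' hx hx' => rw [star_add, map_add, map_add, star_add, hx, hx']
  | tmul a b =>
    rw [TensorProduct.star_tmul, pairMap_tmul, pairMap_tmul, star_mul, ← map_star, ← map_star, h]

theorem isCStarNorm_of_injective (h : ∀ a b, π a * σ b = σ b * π a)
    (hinj : Function.Injective (pairMap π σ)) :
    IsCStarNorm ((normSeminorm ℂ C).comp (pairMap π σ)) where
  eq_zero x hx := hinj (by simpa using hx)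
  mul_le x y := by simpa [pairMap_mul h] using norm_mul_le _ _
  star_mul_self x := by
    simp [pairMap_mul h, pairMap_star h, CStarRing.norm_star_mul_self, sq]

/-- Only the first product has to be faithful, since the maximum already separates points through
it. This lets an arbitrary second pair of representations be compared with a faithful one. -/
theorem isCStarNorm_sup (h : ∀ a b, π a * σ b = σ b * π a)
    {C' : Type*} [CStarAlgebra C'] {π' : A →⋆ₙₐ[ℂ] C'}
    {σ' : B →⋆ₙₐ[ℂ] C'} (h' : ∀ a b, π' a * σ' b = σ' b * π' a)
    (hinj : Function.Injective (pairMap π σ)) :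
    IsCStarNorm ((normSeminorm ℂ C).comp (pairMap π σ) ⊔
      (normSeminorm ℂ C').comp (pairMap π' σ')) where
  eq_zero x hx := hinj (by
    have : ‖pairMap π σ x‖ ≤ 0 := (le_max_left _ _).trans_eq hx
    simpa using this)
  mul_le x y := by
    simp only [Seminorm.sup_apply, Seminorm.comp_apply, coe_normSeminorm, pairMap_mul h,
      pairMap_mul h']
    exact max_le
      ((norm_mul_le _ _).trans (mul_le_mul (le_max_left _ _) (le_max_left _ _) (norm_nonneg _)
        (le_max_of_le_left (norm_nonneg _))))
      ((norm_mul_le _ _).trans (mul_le_mul (le_max_right _ _) (le_max_right _ _) (norm_nonneg _)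
        (le_max_of_le_left (norm_nonneg _))))
  star_mul_self x := by
    simp only [Seminorm.sup_apply, Seminorm.comp_apply, coe_normSeminorm, pairMap_mul h,
      pairMap_mul h', pairMap_star h, pairMap_star h', CStarRing.norm_star_mul_self]
    rcases le_total ‖pairMap π σ x‖ ‖pairMap π' σ' x‖ with hle | hle
    · rw [max_eq_right hle, max_eq_right (mul_self_le_mul_self (norm_nonneg _) hle), sq]
    · rw [max_eq_left hle, max_eq_left (mul_self_le_mul_self (norm_nonneg _) hle), sq]

end PairMap

/-- Over a nuclear C*-algebra, a faithful product of commuting representations dominates every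
other such product. -/
theorem IsNuclear.norm_pairMap_le {A B : Type u} [NonUnitalCStarAlgebra A]
    [NonUnitalCStarAlgebra B] (hA : IsNuclear A) {C C' : Type*} [CStarAlgebra C] [CStarAlgebra C']
    {π : A →⋆ₙₐ[ℂ] C} {σ : B →⋆ₙₐ[ℂ] C} (h : ∀ a b, π a * σ b = σ b * π a)
    (hinj : Function.Injective (pairMap π σ)) {π' : A →⋆ₙₐ[ℂ] C'} {σ' : B →⋆ₙₐ[ℂ] C'}
    (h' : ∀ a b, π' a * σ' b = σ' b * π' a) (x : A ⊗[ℂ] B) :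
    ‖pairMap π' σ' x‖ ≤ ‖pairMap π σ x‖ := by
  -- Uniqueness identifies the faithful norm with its maximum with the other seminorm.
  have := hA B _ _ (isCStarNorm_of_injective h hinj) (isCStarNorm_sup h h' hinj)
  exact (le_max_right _ _).trans_eq (DFunLike.congr_fun this x).symm

/-! ### The dual Hilbert space -/

section DualHilbert

variable {E : Type*} [NormedAddCommGroup E] [InnerProductSpace ℂ E] [CompleteSpace E]

/-- The arguments are swapped because the Riesz identification is conjugate-linear. The dual serves
as second tensor factor because transposition represents the opposite algebra on it complex
linearly. -/
noncomputable instance StrongDual.innerProductSpace : InnerProductSpace ℂ (StrongDual ℂ E) where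
  inner f g := inner ℂ ((InnerProductSpace.toDual ℂ E).symm g)
    ((InnerProductSpace.toDual ℂ E).symm f)
  norm_sq_eq_re_inner f := by
    rw [inner_self_eq_norm_sq, LinearIsometryEquiv.norm_map]
  conj_inner_symm f g := inner_conj_symm _ _
  add_left f g k := by rw [map_add, inner_add_right]
  smul_left f g c := by
    rw [LinearIsometryEquiv.map_smulₛₗ, inner_smul_right]

theorem StrongDual.inner_def (f g : StrongDual ℂ E) :
    inner ℂ f g = inner ℂ ((InnerProductSpace.toDual ℂ E).symm g)
      ((InnerProductSpace.toDual ℂ E).symm f) := rfl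

theorem toDual_symm_comp (f : StrongDual ℂ E) (T : E →L[ℂ] E) :
    (InnerProductSpace.toDual ℂ E).symm (f ∘L T) =
      star T ((InnerProductSpace.toDual ℂ E).symm f) := by
  refine ext_inner_right ℂ fun x => ?_
  rw [InnerProductSpace.toDual_symm_apply, ContinuousLinearMap.star_eq_adjoint,
    ContinuousLinearMap.adjoint_inner_left, InnerProductSpace.toDual_symm_apply]
  rfl

/-- Precomposition with `T` as an operator on the dual Hilbert space. -/
noncomputable def precompDual (T : E →L[ℂ] E) : StrongDual ℂ E →L[ℂ] StrongDual ℂ E :=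
  (ContinuousLinearMap.compL ℂ E E ℂ).flip T

theorem precompDual_apply (T : E →L[ℂ] E) (f : StrongDual ℂ E) : precompDual T f = f ∘L T := rfl

theorem precompDual_mul (S T : E →L[ℂ] E) :
    precompDual (S * T) = precompDual T * precompDual S := rfl

theorem precompDual_star (T : E →L[ℂ] E) : precompDual (star T) = star (precompDual T) := by
  rw [ContinuousLinearMap.star_eq_adjoint (precompDual T), ContinuousLinearMap.eq_adjoint_iff]
  intro f g
  rw [precompDual_apply, precompDual_apply, StrongDual.inner_def, StrongDual.inner_def,
    toDual_symm_comp, toDual_symm_comp, star_star, ContinuousLinearMap.star_eq_adjoint,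
    ContinuousLinearMap.adjoint_inner_left]

theorem precompDual_injective : Function.Injective (precompDual (E := E)) := by
  intro S T h
  ext x
  refine ext_inner_left ℂ fun y => ?_
  exact DFunLike.congr_fun (DFunLike.congr_fun h (InnerProductSpace.toDual ℂ E y)) x

end DualHilbert

/-! ### Operators on the Hilbert tensor product -/

section HilbertTensor

variable (E F : Type*) [NormedAddCommGroup E] [InnerProductSpace ℂ E]
  [NormedAddCommGroup F] [InnerProductSpace ℂ F]

/-- The Hilbert tensor product of two inner product spaces. -/
abbrev HilbertTensor := UniformSpace.Completion (E ⊗[ℂ] F)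

variable {E F}

/-- The operator `S ⊗ T` on the Hilbert tensor product. -/
noncomputable def tensorOp (S : E →L[ℂ] E) (T : F →L[ℂ] F) :
    HilbertTensor E F →L[ℂ] HilbertTensor E F :=
  (TensorProduct.mapL S T).completion

theorem tensorOp_coe_tmul (S : E →L[ℂ] E) (T : F →L[ℂ] F) (x : E) (y : F) :
    tensorOp S T ((x ⊗ₜ[ℂ] y : E ⊗[ℂ] F) : HilbertTensor E F) =
      ((S x ⊗ₜ[ℂ] T y : E ⊗[ℂ] F) : HilbertTensor E F) := by
  rw [tensorOp, ContinuousLinearMap.completion_apply_coe, TensorProduct.mapL_tmul]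

theorem HilbertTensor.clm_ext {X : Type*} [NormedAddCommGroup X] [NormedSpace ℂ X]
    {S T : HilbertTensor E F →L[ℂ] X}
    (h : ∀ x y, S ((x ⊗ₜ[ℂ] y : E ⊗[ℂ] F) : HilbertTensor E F) =
      T ((x ⊗ₜ[ℂ] y : E ⊗[ℂ] F) : HilbertTensor E F)) : S = T := by
  ext z
  induction z using UniformSpace.Completion.induction_on with
  | hp => exact isClosed_eq S.continuous T.continuous
  | ih z =>
    induction z with
    | zero => rw [UniformSpace.Completion.coe_zero, map_zero, map_zero]
    | tmul x y => exact h x y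
    | add x y hx hy => rw [UniformSpace.Completion.coe_add, map_add, map_add, hx, hy]

theorem tensorOp_mul (S S' : E →L[ℂ] E) (T T' : F →L[ℂ] F) :
    tensorOp (S * S') (T * T') = tensorOp S T * tensorOp S' T' :=
  HilbertTensor.clm_ext fun x y => by
    rw [mul_apply_eq_comp, tensorOp_coe_tmul, tensorOp_coe_tmul, tensorOp_coe_tmul]
    rfl

theorem tensorOp_one : tensorOp (1 : E →L[ℂ] E) (1 : F →L[ℂ] F) = 1 :=
  HilbertTensor.clm_ext (tensorOp_coe_tmul _ _)

theorem tensorOp_add_left (S S' : E →L[ℂ] E) (T : F →L[ℂ] F) :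
    tensorOp (S + S') T = tensorOp S T + tensorOp S' T :=
  HilbertTensor.clm_ext fun x y => by
    rw [add_apply, tensorOp_coe_tmul, tensorOp_coe_tmul, tensorOp_coe_tmul,
      ← UniformSpace.Completion.coe_add, ← TensorProduct.add_tmul]
    rfl

theorem tensorOp_add_right (S : E →L[ℂ] E) (T T' : F →L[ℂ] F) :
    tensorOp S (T + T') = tensorOp S T + tensorOp S T' :=
  HilbertTensor.clm_ext fun x y => by
    rw [add_apply, tensorOp_coe_tmul, tensorOp_coe_tmul, tensorOp_coe_tmul,
      ← UniformSpace.Completion.coe_add, ← TensorProduct.tmul_add]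
    rfl

theorem tensorOp_smul_left (c : ℂ) (S : E →L[ℂ] E) (T : F →L[ℂ] F) :
    tensorOp (c • S) T = c • tensorOp S T :=
  HilbertTensor.clm_ext fun x y => by
    rw [smul_apply, tensorOp_coe_tmul, tensorOp_coe_tmul,
      ← UniformSpace.Completion.coe_smul, TensorProduct.smul_tmul']
    rfl

theorem tensorOp_smul_right (c : ℂ) (S : E →L[ℂ] E) (T : F →L[ℂ] F) :
    tensorOp S (c • T) = c • tensorOp S T :=
  HilbertTensor.clm_ext fun x y => by
    rw [smul_apply, tensorOp_coe_tmul, tensorOp_coe_tmul,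
      ← UniformSpace.Completion.coe_smul, ← TensorProduct.tmul_smul]
    rfl

/-- Operators of the form `∑ Sᵢ ⊗ Tᵢ` determine the element `∑ aᵢ ⊗ bᵢ`. -/
theorem injective_of_apply_tmul_eq_tensorOp {A B : Type*} [AddCommGroup A] [Module ℂ A]
    [AddCommGroup B] [Module ℂ B] (π : A →ₗ[ℂ] (E →L[ℂ] E)) (σ : B →ₗ[ℂ] (F →L[ℂ] F))
    (hπ : Function.Injective π) (hσ : Function.Injective σ)
    (Λ : A ⊗[ℂ] B →ₗ[ℂ] (HilbertTensor E F →L[ℂ] HilbertTensor E F))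
    (hΛ : ∀ a b, Λ (a ⊗ₜ b) = tensorOp (π a) (σ b)) : Function.Injective Λ := by
  classical
  rw [injective_iff_map_eq_zero]
  intro z hz
  let b := Module.Basis.ofVectorSpace ℂ B
  obtain ⟨c, rfl⟩ := (TensorProduct.equivFinsuppOfBasisRight (M := A) b).symm.surjective z
  suffices h : ∀ i, c i = 0 by
    rw [show c = 0 from Finsupp.ext h, map_zero]
  rw [TensorProduct.equivFinsuppOfBasisRight_symm_apply, Finsupp.sum, map_sum] at hz
  -- Slicing the first leg by a matrix coefficient leaves an element of B killed by σ. Faithfulness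
  -- of σ and independence of the basis then force every coefficient of π (c i) to vanish.
  have key : ∀ x x' : E, ∑ i ∈ c.support, inner ℂ x' (π (c i) x) • b i = 0 := by
    intro x x'
    refine (injective_iff_map_eq_zero σ).mp hσ _ ?_
    ext y
    refine ext_inner_left ℂ fun y' => ?_
    have h1 : inner ℂ ((x' ⊗ₜ[ℂ] y' : E ⊗[ℂ] F) : HilbertTensor E F)
        ((∑ i ∈ c.support, Λ (c i ⊗ₜ[ℂ] b i))
          ((x ⊗ₜ[ℂ] y : E ⊗[ℂ] F) : HilbertTensor E F)) = 0 := by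
      rw [hz, zero_apply, inner_zero_right]
    rw [sum_apply, inner_sum] at h1
    rw [map_sum, sum_apply, inner_sum, zero_apply,
      inner_zero_right, ← h1]
    refine Finset.sum_congr rfl fun i _ => ?_
    rw [hΛ, tensorOp_coe_tmul, UniformSpace.Completion.inner_coe, TensorProduct.inner_tmul,
      map_smul, smul_apply, inner_smul_right]
  intro i
  by_cases hi : i ∈ c.support
  · refine (injective_iff_map_eq_zero π).mp hπ _ ?_
    ext x
    refine ext_inner_left ℂ fun x' => ?_
    rw [zero_apply, inner_zero_right]
    exact linearIndependent_iff'.mp b.linearIndependent _ _ (key x x') i hi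
  · exact Finsupp.notMem_support_iff.mp hi

variable [CompleteSpace E] [CompleteSpace F]

theorem tensorOp_star (S : E →L[ℂ] E) (T : F →L[ℂ] F) :
    tensorOp (star S) (star T) = star (tensorOp S T) := by
  rw [ContinuousLinearMap.star_eq_adjoint (tensorOp S T), ContinuousLinearMap.eq_adjoint_iff]
  intro z w
  induction z, w using UniformSpace.Completion.induction_on₂ with
  | hp =>
    exact isClosed_eq (((tensorOp (star S) (star T)).continuous.comp continuous_fst).inner
      continuous_snd) (continuous_fst.inner ((tensorOp S T).continuous.comp continuous_snd))
  | ih z w =>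
    rw [tensorOp, tensorOp, ContinuousLinearMap.completion_apply_coe,
      ContinuousLinearMap.completion_apply_coe, UniformSpace.Completion.inner_coe,
      UniformSpace.Completion.inner_coe]
    induction z with
    | zero => simp
    | add z z' hz hz' => rw [map_add, inner_add_left, inner_add_left, hz, hz']
    | tmul x y =>
      induction w with
      | zero => simp
      | add w w' hw hw' => rw [map_add, inner_add_right, inner_add_right, hw, hw']
      | tmul x' y' =>
        rw [TensorProduct.mapL_tmul, TensorProduct.mapL_tmul, TensorProduct.inner_tmul,
          TensorProduct.inner_tmul, ContinuousLinearMap.star_eq_adjoint,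
          ContinuousLinearMap.star_eq_adjoint, ContinuousLinearMap.adjoint_inner_left,
          ContinuousLinearMap.adjoint_inner_left]

variable (E F) in
/-- `S ↦ S ⊗ 1` -/
noncomputable def tensorLeft :
    (E →L[ℂ] E) →⋆ₙₐ[ℂ] (HilbertTensor E F →L[ℂ] HilbertTensor E F) where
  toFun S := tensorOp S 1
  map_smul' c S := tensorOp_smul_left c S 1
  map_zero' := by
    have := tensorOp_smul_left (0 : ℂ) (0 : E →L[ℂ] E) (1 : F →L[ℂ] F)
    rwa [zero_smul, zero_smul] at this
  map_add' S T := tensorOp_add_left S T 1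
  map_mul' S T := by rw [← tensorOp_mul, one_mul]
  map_star' S := by rw [← tensorOp_star, star_one]

variable (E) in
/-- `T ↦ 1 ⊗ Tᵗ`, where the transpose `Tᵗ` acts on the dual Hilbert space -/
noncomputable def tensorDualRight : (E →L[ℂ] E)ᵐᵒᵖ →⋆ₙₐ[ℂ]
    (HilbertTensor E (StrongDual ℂ E) →L[ℂ] HilbertTensor E (StrongDual ℂ E)) where
  toFun T := tensorOp 1 (precompDual T.unop)
  map_smul' c T := by
    rw [MonoidHom.id_apply, ← tensorOp_smul_right]
    congr 1
    exact map_smul _ c T.unop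
  map_zero' := by
    have := tensorOp_smul_right (0 : ℂ) (1 : E →L[ℂ] E) (0 : StrongDual ℂ E →L[ℂ] StrongDual ℂ E)
    rw [zero_smul, zero_smul] at this
    rw [unop_zero, ← this]
    congr 1
    exact map_zero _
  map_add' S T := by
    rw [← tensorOp_add_right]
    congr 1
    exact map_add _ S.unop T.unop
  map_mul' S T := by rw [← tensorOp_mul, one_mul, unop_mul, precompDual_mul]
  map_star' S := by rw [← tensorOp_star, star_one, unop_star, precompDual_star]

theorem tensorLeft_mul_tensorDualRight (S : E →L[ℂ] E) (T : (E →L[ℂ] E)ᵐᵒᵖ) :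
    tensorLeft E _ S * tensorDualRight E T = tensorOp S (precompDual T.unop) := by
  change tensorOp _ _ * tensorOp _ _ = _
  rw [← tensorOp_mul, mul_one, one_mul]

theorem tensorDualRight_mul_tensorLeft (S : E →L[ℂ] E) (T : (E →L[ℂ] E)ᵐᵒᵖ) :
    tensorDualRight E T * tensorLeft E _ S = tensorOp S (precompDual T.unop) := by
  change tensorOp _ _ * tensorOp _ _ = _
  rw [← tensorOp_mul, mul_one, one_mul]

end HilbertTensor

/-! ### Vector functionals of bimodules -/

namespace HilbertStarBimodule

variable {A : Type u} [NonUnitalCStarAlgebra A] {H : Type v}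
  [NormedAddCommGroup H] [InnerProductSpace ℂ H] [CompleteSpace H]
  (M : HilbertStarBimodule A H)

theorem left_mul_right_comm (a : A) (b : Aᵐᵒᵖ) : M.left a * M.right b = M.right b * M.left a := by
  ext ξ
  exact M.left_right_comm a b.unop ξ

variable {M}

/-- An approximate unit acts on a non-degenerate representation by operators that tend strongly to
the identity. -/
theorem tendsto_apply_of_dense {B : Type*} [NonUnitalCStarAlgebra B] (σ : B →⋆ₙₐ[ℂ] (H →L[ℂ] H))
    {α : Type*} {l : Filter α} (e : α → B)
    (hd : Dense (Submodule.span ℂ {η : H | ∃ (a : B) (ξ : H), η = σ a ξ} : Set H))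
    (hn : ∀ᶠ i in l, ‖e i‖ ≤ 1) (he : ∀ a, Tendsto (fun i => e i * a) l (𝓝 a)) (ξ : H) :
    Tendsto (fun i => σ (e i) ξ) l (𝓝 ξ) := by
  have hσ : Continuous σ := AddMonoidHomClass.continuous_of_bound σ 1 fun c => by
    simpa using NonUnitalStarAlgHom.norm_apply_le σ c
  have hspan : ∀ η ∈ Submodule.span ℂ {η : H | ∃ (a : B) (ξ : H), η = σ a ξ},
      Tendsto (fun i => σ (e i) η) l (𝓝 η) := by
    intro η hη
    induction hη using Submodule.span_induction with
    | mem η h =>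
      obtain ⟨a, ζ, rfl⟩ := h
      have := ((ContinuousLinearMap.apply ℂ H ζ).continuous.tendsto _).comp
        ((hσ.tendsto a).comp (he a))
      refine this.congr fun i => ?_
      simp [map_mul]
    | zero => simpa using tendsto_const_nhds
    | add x y _ _ hx hy => simpa using hx.add hy
    | smul c x _ hx => simpa using hx.const_smul c
  rw [Metric.tendsto_nhds]
  intro ε hε
  obtain ⟨η, hη, hd'⟩ := Metric.dense_iff.mp hd ξ (ε / 3) (by positivity)
  rw [Metric.mem_ball, dist_eq_norm] at hη
  filter_upwards [hn, Metric.tendsto_nhds.mp (hspan η hd') (ε / 3) (by positivity)] with i hi hi'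
  rw [dist_eq_norm] at hi' ⊢
  have h1 : ‖σ (e i) (ξ - η)‖ ≤ ‖ξ - η‖ := by
    refine ((σ (e i)).le_of_opNorm_le ((NonUnitalStarAlgHom.norm_apply_le σ _).trans hi) _).trans ?_
    rw [one_mul]
  rw [norm_sub_rev] at hη
  calc ‖σ (e i) ξ - ξ‖ = ‖σ (e i) (ξ - η) + (σ (e i) η - η) + (η - ξ)‖ := by
        rw [map_sub]; congr 1; abel
    _ ≤ ‖σ (e i) (ξ - η)‖ + ‖σ (e i) η - η‖ + ‖η - ξ‖ := norm_add₃_le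
    _ < ε := by rw [norm_sub_rev η ξ]; linarith

theorem dense_right (hM : M.IsNondegenerate) :
    Dense (Submodule.span ℂ {η : H | ∃ (a : Aᵐᵒᵖ) (ξ : H), η = M.right a ξ} : Set H) :=
  hM.right_dense.mono (Submodule.span_mono (by
    rintro _ ⟨a, ξ, rfl⟩
    exact ⟨op a, ξ, rfl⟩))

theorem pairMap_mul_tmul_apply (hM : M.IsNondegenerate) (x y : 𝓜(ℂ, A)) (a b : A) (ξ : H) :
    pairMap M.left M.right (x.fst a ⊗ₜ[ℂ] op (y.snd b)) ξ =
      M.rightMul y (M.leftMul x (pairMap M.left M.right (a ⊗ₜ[ℂ] op b) ξ)) := by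
  rw [pairMap_tmul, pairMap_tmul]
  change M.left (x.fst a) (M.right (op (y.snd b)) ξ) =
    M.rightMul y (M.leftMul x (M.left a (M.right (op b) ξ)))
  rw [leftMul_apply M hM, M.left_right_comm, M.left_right_comm, rightMul_apply M hM]

theorem rightMul_rightMul_of_inv (hM : M.IsNondegenerate) {x y : 𝓜(ℂ, A)}
    (hxy : ∀ a, y.snd (x.snd a) = a) (ξ : H) : M.rightMul y (M.rightMul x ξ) = ξ := by
  have : (M.rightMul y).comp (M.rightMul x) = ContinuousLinearMap.id ℂ H := by
    refine ContinuousLinearMap.ext_on hM.right_dense ?_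
    rintro _ ⟨a, ξ, rfl⟩
    rw [ContinuousLinearMap.comp_apply, rightMul_apply M hM, rightMul_apply M hM, hxy]
    rfl
  exact DFunLike.congr_fun this ξ

/-- Let `α` and `β` be commuting representations of the nuclear C*-algebra `A` and its opposite
with faithful product. Then the vector state of `ξ` extends to a state `φ` for which `φ u` is close
to `1` for those unitary multipliers `u = x ⊗ y` for which `x · ξ · y` is close to `ξ`. -/
theorem exists_state {K : Type*} [NormedAddCommGroup K] [InnerProductSpace ℂ K] [CompleteSpace K]
    {α : A →⋆ₙₐ[ℂ] (K →L[ℂ] K)} {β : Aᵐᵒᵖ →⋆ₙₐ[ℂ] (K →L[ℂ] K)}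
    (hαβ : ∀ a b, α a * β b = β b * α a)
    (hA : IsNuclear A) (hinj : Function.Injective (pairMap α β)) (hM : M.IsNondegenerate)
    {ξ : H} (hξ : ‖ξ‖ = 1) :
    ∃ φ : StrongDual ℂ (K →L[ℂ] K), ‖φ‖ ≤ 1 ∧ φ 1 = 1 ∧
      ∀ (x y : 𝓜(ℂ, A)) (u : K →L[ℂ] K), star u * u = 1 →
        (∀ a b, u * pairMap α β (a ⊗ₜ op b) = pairMap α β (x.fst a ⊗ₜ op (y.snd b))) →
        sqForm φ (u - 1) ≤ 2 * ‖M.rightMul y (M.leftMul x ξ) - ξ‖ ^ 2 := by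
  have hle := hA.norm_pairMap_le hαβ hinj M.left_mul_right_comm
  set Λ := pairMap α β with hΛ
  set π := pairMap M.left M.right with hπ
  have hMc := M.left_mul_right_comm
  -- The vector functional z ↦ ⟨ξ, π(z) ξ⟩ is bounded by ‖π z‖, hence by ‖Λ z‖ through nuclearity.
  obtain ⟨φ, hφ, hφΛ⟩ := exists_strongDual_of_norm_le Λ
    (((innerSL ℂ ξ).comp (ContinuousLinearMap.apply ℂ H ξ)).toLinearMap ∘ₗ π) (fun z => by
      refine (norm_inner_le_norm ξ (π z ξ)).trans ?_
      rw [hξ, one_mul]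
      exact ((π z).le_of_opNorm_le (hle z) ξ).trans_eq (by rw [hξ, mul_one]))
  replace hφΛ : ∀ z, φ (Λ z) = inner ℂ ξ (π z ξ) := hφΛ
  have hsq : ∀ z, φ (star (Λ z) * Λ z) = (‖π z ξ‖ ^ 2 : ℝ) := fun z => by
    rw [hΛ, ← pairMap_star hαβ, ← pairMap_mul hαβ, ← hΛ, hφΛ, hπ, pairMap_mul hMc,
      pairMap_star hMc, ← hπ]
    have : inner ℂ ξ ((star (π z) * π z) ξ) = inner ℂ (π z ξ) (π z ξ) :=
      ContinuousLinearMap.adjoint_inner_right (π z) ξ (π z ξ)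
    rw [this, inner_self_eq_norm_sq_to_K]
    norm_cast
  have hsqF : ∀ z, sqForm φ (Λ z) = ‖π z ξ‖ ^ 2 := fun z => by
    rw [sqForm, hsq, Complex.ofReal_re]
  let _ := CStarAlgebra.spectralOrder A
  have _ := CStarAlgebra.spectralOrderedRing A
  have hau := CStarAlgebra.increasingApproximateUnit A
  have hne : (CStarAlgebra.approximateUnit A).NeBot := hau.neBot
  set l := CStarAlgebra.approximateUnit A
  -- With e running through an approximate unit of A, the elements e ⊗ e act on H by operators
  -- tending strongly to the identity.
  let E : A → A ⊗[ℂ] Aᵐᵒᵖ := fun e => e ⊗ₜ op e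
  have hR := tendsto_apply_of_dense M.right (l := l) (fun e => op e) (dense_right hM)
    (hau.eventually_norm.mono fun e he => (norm_op e).trans_le he)
    (fun a => (continuous_op.tendsto _).comp (hau.tendsto_mul_left a.unop)) ξ
  have hL := tendsto_apply_of_dense M.left (l := l) (fun e => e) hM.left_dense
    hau.eventually_norm hau.tendsto_mul_right ξ
  have hE : Tendsto (fun e => π (E e) ξ) l (𝓝 ξ) := by
    have h0 : Tendsto (fun e => M.left e (M.right (op e) ξ - ξ)) l (𝓝 0) := by
      refine squeeze_zero_norm' ?_ (tendsto_iff_norm_sub_tendsto_zero.mp hR)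
      filter_upwards [hau.eventually_norm] with e he
      refine ((M.left e).le_of_opNorm_le
        ((NonUnitalStarAlgHom.norm_apply_le M.left e).trans he) _).trans ?_
      rw [one_mul]
    have := h0.add hL
    rw [zero_add] at this
    refine this.congr fun e => ?_
    rw [map_sub, sub_add_cancel, hπ, pairMap_tmul]
    rfl
  have hφE : Tendsto (fun e => φ (Λ (E e))) l (𝓝 1) := by
    have : Tendsto (fun e => inner ℂ ξ (π (E e) ξ)) l (𝓝 (inner ℂ ξ ξ)) :=
      tendsto_const_nhds.inner hE
    rw [inner_self_eq_norm_sq_to_K, hξ] at this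
    simpa [hφΛ] using this
  have hφE' : Tendsto (fun e => φ (star (Λ (E e)))) l (𝓝 1) := by
    have h2 := (Complex.continuous_conj.tendsto _).comp hφE
    rw [map_one] at h2
    refine h2.congr fun e => ?_
    rw [Function.comp_apply, hφΛ, inner_conj_symm, hΛ, ← pairMap_star hαβ, ← hΛ, hφΛ, hπ,
      pairMap_star hMc, ← hπ]
    exact (ContinuousLinearMap.adjoint_inner_right (π (E e)) ξ ξ).symm
  have hQE : Tendsto (fun e => ‖π (E e) ξ‖ ^ 2) l (𝓝 1) := by
    simpa [hξ] using hE.norm.pow 2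
  have hnE : ∀ᶠ e in l, ‖Λ (E e)‖ ≤ 1 := by
    filter_upwards [hau.eventually_norm] with e he
    rw [hΛ, pairMap_tmul]
    refine (norm_mul_le _ _).trans (mul_le_one₀ ((NonUnitalStarAlgHom.norm_apply_le α e).trans he)
      (norm_nonneg _) ((NonUnitalStarAlgHom.norm_apply_le β (op e)).trans ?_))
    rwa [norm_op]
  -- Contractivity at 1 and, in the limit, at 1 - 2 Λ(E e)* Λ(E e) puts φ 1 in the closed unit discs
  -- around 0 and 2, which meet only at 1.
  have h1 : φ 1 = 1 := by
    have ha : ‖φ 1 - 2 * 1‖ ≤ 1 := by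
      have hl : Tendsto (fun e => ‖φ 1 - 2 * (((‖π (E e) ξ‖ ^ 2 : ℝ)) : ℂ)‖) l
          (𝓝 ‖φ 1 - 2 * ((1 : ℝ) : ℂ)‖) :=
        (tendsto_const_nhds.sub
          (tendsto_const_nhds.mul ((Complex.continuous_ofReal.tendsto _).comp hQE))).norm
      rw [Complex.ofReal_one] at hl
      refine le_of_tendsto hl ?_
      filter_upwards [hnE] with e he
      have := φ.le_of_opNorm_le_of_le hφ (norm_one_sub_two_smul_star_mul_self_le he)
      rwa [map_sub, map_smul, hsq, smul_eq_mul, one_mul] at this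
    have hb : ‖φ 1‖ ≤ 1 := by
      have := φ.le_of_opNorm_le_of_le (x := (1 : K →L[ℂ] K)) hφ ContinuousLinearMap.norm_id_le
      rwa [one_mul] at this
    have ha2 : (φ 1 - 2 * 1).re ^ 2 + (φ 1 - 2 * 1).im ^ 2 ≤ 1 := by
      have := pow_le_one₀ (n := 2) (norm_nonneg _) ha
      rw [Complex.sq_norm, Complex.normSq_apply] at this
      nlinarith
    have hb2 : (φ 1).re ^ 2 + (φ 1).im ^ 2 ≤ 1 := by
      have := pow_le_one₀ (n := 2) (norm_nonneg _) hb
      rw [Complex.sq_norm, Complex.normSq_apply] at this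
      nlinarith
    simp at ha2
    have hre : (φ 1).re = 1 := by nlinarith [sq_nonneg ((φ 1).im), sq_nonneg ((φ 1).re - 1)]
    have him : (φ 1).im = 0 := by
      rw [hre] at hb2
      nlinarith [sq_nonneg ((φ 1).im)]
    exact Complex.ext (by simpa using hre) (by simpa using him)
  refine ⟨φ, hφ, h1, fun x y u hu huΛ => ?_⟩
  -- Expanding the square gives the limit 1 - 1 - 1 + 1.
  have hQ1 : Tendsto (fun e => sqForm φ (1 - Λ (E e))) l (𝓝 0) := by
    have : ∀ e, sqForm φ (1 - Λ (E e)) =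
        1 - (φ (Λ (E e))).re - (φ (star (Λ (E e)))).re + ‖π (E e) ξ‖ ^ 2 := fun e => by
      rw [← hsqF, sqForm, sqForm, star_sub, star_one, sub_mul, one_mul, mul_sub, mul_one]
      simp only [map_sub, h1, Complex.sub_re, Complex.one_re]
      ring
    simp only [this]
    have h3 := ((tendsto_const_nhds (x := (1 : ℝ))).sub
      ((Complex.continuous_re.tendsto _).comp hφE)).sub
      ((Complex.continuous_re.tendsto _).comp hφE') |>.add hQE
    simpa using h3
  -- By `huΛ`, u Λ(E e) stays in the range of Λ, where φ is the vector functional of ξ, so the form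
  -- value is a norm in H.
  have hQ2 : Tendsto (fun e => sqForm φ (u * Λ (E e) - Λ (E e))) l
      (𝓝 (‖M.rightMul y (M.leftMul x ξ) - ξ‖ ^ 2)) := by
    have : ∀ e, sqForm φ (u * Λ (E e) - Λ (E e)) =
        ‖M.rightMul y (M.leftMul x (π (E e) ξ)) - π (E e) ξ‖ ^ 2 := fun e => by
      rw [huΛ, ← map_sub, hsqF, map_sub, hπ, ← pairMap_mul_tmul_apply hM]
      rfl
    simp only [this]
    exact ((((M.rightMul y).continuous.comp (M.leftMul x).continuous).tendsto _ |>.comp hE).sub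
      hE).norm.pow 2
  have h4 := (hQ2.const_mul 2).add (hQ1.const_mul 8)
  rw [mul_zero, add_zero] at h4
  exact ge_of_tendsto' h4 fun e => sqForm_sub_one_le hφ h1 hu _

end HilbertStarBimodule

/-! ### Translations and the reduced group C*-algebra -/

section Translations

set_option linter.unusedSectionVars false

variable {G : Type u} [Group G] [TopologicalSpace G] [IsTopologicalGroup G]
  [LocallyCompactSpace G] [T2Space G] [MeasurableSpace G] [BorelSpace G]
  (μ : Measure G) [μ.IsHaarMeasure] [μ.Regular]

theorem leftRegular_mul (s t : G) (ξ : Lp ℂ 2 μ) :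
    leftRegular μ (s * t) ξ = leftRegular μ s (leftRegular μ t ξ) := by
  rw [leftRegular, leftRegular, leftRegular, mul_inv_rev, DomMulAct.mk_mul, mul_smul]

theorem leftRegular_one (ξ : Lp ℂ 2 μ) : leftRegular μ 1 ξ = ξ := by
  rw [leftRegular, inv_one, DomMulAct.mk_one, one_smul]

/-- The unitary operator `λ(s)` on `L²(G, μ)`. -/
noncomputable def leftRegularL (s : G) : Lp ℂ 2 μ →L[ℂ] Lp ℂ 2 μ :=
  LinearMap.mkContinuous
    { toFun := leftRegular μ s
      map_add' := fun ξ η => by simp only [leftRegular, smul_add]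
      map_smul' := fun c ξ => smul_comm _ _ _ } 1
    fun ξ => by rw [one_mul]; exact (norm_leftRegular μ s ξ).le

@[simp]
theorem leftRegularL_apply (s : G) (ξ : Lp ℂ 2 μ) : leftRegularL μ s ξ = leftRegular μ s ξ := rfl

theorem leftRegularL_mul (s t : G) :
    leftRegularL μ (s * t) = leftRegularL μ s * leftRegularL μ t := by
  ext1 ξ
  exact leftRegular_mul μ s t ξ

theorem leftRegularL_one : leftRegularL μ (1 : G) = 1 := by
  ext1 ξ
  exact leftRegular_one μ ξ

theorem star_leftRegularL (s : G) : star (leftRegularL μ s) = leftRegularL μ s⁻¹ := by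
  have h : star (leftRegularL μ s) * leftRegularL μ s = 1 := by
    rw [ContinuousLinearMap.star_eq_adjoint]
    exact (ContinuousLinearMap.norm_map_iff_adjoint_comp_self _).mp (norm_leftRegular μ s)
  have h2 : leftRegularL μ s * leftRegularL μ s⁻¹ = 1 := by
    rw [← leftRegularL_mul, mul_inv_cancel, leftRegularL_one]
  exact left_inv_eq_right_inv h h2

/-- The function `t ↦ c * f (g t)` for a homeomorphism `g`. -/
noncomputable def smulCompHomeomorph (c : ℂ) (g : G ≃ₜ G) (f : C_c(G, ℂ)) : C_c(G, ℂ) where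
  toFun t := c * f (g t)
  continuous_toFun := continuous_const.mul (f.continuous.comp g.continuous)
  hasCompactSupport' := (f.hasCompactSupport.comp_homeomorph g).mul_left

theorem leftRegularL_mul_regularRep (s : G) (f : C_c(G, ℂ)) :
    leftRegularL μ s * regularRep μ f =
      regularRep μ (smulCompHomeomorph 1 (Homeomorph.mulLeft s⁻¹) f) := by
  ext1 ξ
  rw [mul_apply_eq_comp, regularRep_apply, regularRep_apply,
    ← ContinuousLinearMap.integral_comp_comm _ (integrable_smul_leftRegular μ f ξ)]
  refine Eq.trans ?_ (integral_mul_left_eq_self (μ := μ) _ s)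
  refine integral_congr_ae (Eventually.of_forall fun t => ?_)
  simp [smulCompHomeomorph, leftRegular_mul]

/-- Right translation preserves left invariance, so uniqueness of Haar measure applies. The constant
is governed by the modular function, but its value never matters. -/
theorem exists_map_mul_right_eq_smul (s : G) :
    ∃ c : NNReal, μ.map (· * s) = c • μ := by
  have : (μ.map (· * s)).Regular := Measure.Regular.map (Homeomorph.mulRight s)
  exact ⟨_, Measure.isMulLeftInvariant_eq_smul_of_regular _ μ⟩

theorem regularRep_mul_leftRegularL (s : G) (f : C_c(G, ℂ)) :
    ∃ c : ℂ, regularRep μ f * leftRegularL μ s =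
      regularRep μ (smulCompHomeomorph c (Homeomorph.mulRight s⁻¹) f) := by
  obtain ⟨c, hc⟩ := exists_map_mul_right_eq_smul μ s
  refine ⟨((c : ℝ) : ℂ), ?_⟩
  ext1 ξ
  rw [mul_apply_eq_comp, regularRep_apply, regularRep_apply]
  have h := integral_map_equiv (μ := μ) (MeasurableEquiv.mulRight s)
    fun t => f (t * s⁻¹) • leftRegular μ t ξ
  rw [MeasurableEquiv.coe_mulRight, hc, integral_smul_nnreal_measure] at h
  simp only [mul_inv_cancel_right] at h
  simp only [leftRegularL_apply, ← leftRegular_mul]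
  rw [← h, NNReal.smul_def, ← integral_smul]
  refine integral_congr_ae (Eventually.of_forall fun t => ?_)
  change (c : ℝ) • (f (t * s⁻¹) • leftRegular μ t ξ) =
    (((c : ℝ) : ℂ) * f (t * s⁻¹)) • leftRegular μ t ξ
  rw [mul_smul]
  exact RCLike.real_smul_eq_coe_smul (K := ℂ) (c : ℝ) _

theorem leftRegularL_mul_mem_and (a : Lp ℂ 2 μ →L[ℂ] Lp ℂ 2 μ)
    (ha : a ∈ reducedGroupCStarAlgebra μ) (s : G) :
    leftRegularL μ s * a ∈ reducedGroupCStarAlgebra μ ∧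
      a * leftRegularL μ s ∈ reducedGroupCStarAlgebra μ := by
  have hcl : IsClosed (reducedGroupCStarAlgebra μ : Set (Lp ℂ 2 μ →L[ℂ] Lp ℂ 2 μ)) :=
    NonUnitalStarSubalgebra.isClosed_topologicalClosure _
  have hsub : NonUnitalStarAlgebra.adjoin ℂ (Set.range (regularRep μ)) ≤
      reducedGroupCStarAlgebra μ := NonUnitalStarSubalgebra.le_topologicalClosure _
  have hgen : ∀ f, regularRep μ f ∈ reducedGroupCStarAlgebra μ := fun f =>
    hsub (NonUnitalStarAlgebra.subset_adjoin ℂ _ ⟨f, rfl⟩)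
  -- Both sides and all s are treated together: the adjoint of λ(s⁻¹) x is x* λ(s), so the star case
  -- exchanges left and right and inverts s.
  have hadj : ∀ a ∈ NonUnitalStarAlgebra.adjoin ℂ (Set.range (regularRep μ)), ∀ s,
      leftRegularL μ s * a ∈ reducedGroupCStarAlgebra μ ∧
        a * leftRegularL μ s ∈ reducedGroupCStarAlgebra μ := by
    intro a ha
    induction ha using NonUnitalStarAlgebra.adjoin_induction with
    | mem a h =>
      obtain ⟨f, rfl⟩ := h
      intro s
      refine ⟨?_, ?_⟩
      · rw [leftRegularL_mul_regularRep]
        exact hgen _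
      · obtain ⟨c, hc⟩ := regularRep_mul_leftRegularL μ s f
        rw [hc]
        exact hgen _
    | add x y _ _ hx hy =>
      intro s
      rw [mul_add, add_mul]
      exact ⟨add_mem (hx s).1 (hy s).1, add_mem (hx s).2 (hy s).2⟩
    | zero =>
      intro s
      rw [mul_zero, zero_mul]
      exact ⟨zero_mem _, zero_mem _⟩
    | mul x y hx' hy' hx hy =>
      intro s
      rw [← mul_assoc, mul_assoc x]
      exact ⟨mul_mem (hx s).1 (hsub hy'), mul_mem (hsub hx') (hy s).2⟩
    | smul c x _ hx =>
      intro s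
      rw [mul_smul_comm, smul_mul_assoc]
      exact ⟨SMulMemClass.smul_mem c (hx s).1, SMulMemClass.smul_mem c (hx s).2⟩
    | star x _ hx =>
      intro s
      have h1 := star_mem (hx s⁻¹).1
      have h2 := star_mem (hx s⁻¹).2
      rw [star_mul, star_leftRegularL, inv_inv] at h1 h2
      exact ⟨h2, h1⟩
  have ha' : a ∈ closure
      (NonUnitalStarAlgebra.adjoin ℂ (Set.range (regularRep μ)) : Set _) := ha
  constructor
  · exact (hcl.preimage (continuous_const_mul (leftRegularL μ s))).closure_subset_iff.mpr
      (fun x hx => (hadj x hx s).1) ha'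
  · exact (hcl.preimage (continuous_mul_const (leftRegularL μ s))).closure_subset_iff.mpr
      (fun x hx => (hadj x hx s).2) ha'

/-- The multiplier of `C*_r(G)` given by `λ(s)`. -/
noncomputable def translationMultiplier (s : G) : 𝓜(ℂ, reducedGroupCStarAlgebra μ) where
  fst := ((ContinuousLinearMap.mul ℂ _ (leftRegularL μ s)).comp
    (reducedGroupCStarAlgebra μ).toSubmodule.subtypeL).codRestrict
      (reducedGroupCStarAlgebra μ).toSubmodule fun a => (leftRegularL_mul_mem_and μ a a.2 s).1
  snd := (((ContinuousLinearMap.mul ℂ (Lp ℂ 2 μ →L[ℂ] Lp ℂ 2 μ)).flip (leftRegularL μ s)).comp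
    (reducedGroupCStarAlgebra μ).toSubmodule.subtypeL).codRestrict
      (reducedGroupCStarAlgebra μ).toSubmodule fun a => (leftRegularL_mul_mem_and μ a a.2 s).2
  central _ _ := Subtype.ext (mul_assoc _ _ _)

theorem coe_translationMultiplier_snd (s : G) (a : reducedGroupCStarAlgebra μ) :
    ((translationMultiplier μ s).snd a : Lp ℂ 2 μ →L[ℂ] Lp ℂ 2 μ) = a * leftRegularL μ s := rfl

/-! ### Multiplication operators -/

theorem memLp_mul_of_bounded (h : G →ᵇ ℝ) (ξ : Lp ℂ 2 μ) :
    MemLp (fun t => (h t : ℂ) * ξ t) 2 μ :=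
  (Lp.memLp ξ).of_le_mul (c := ‖h‖)
    ((Complex.continuous_ofReal.comp h.continuous).aestronglyMeasurable.mul
      (Lp.aestronglyMeasurable ξ))
    (Eventually.of_forall fun t => by
      rw [norm_mul, Complex.norm_real]
      exact mul_le_mul_of_nonneg_right (h.norm_coe_le_norm t) (norm_nonneg _))

/-- Multiplication by a bounded continuous function as an operator on `L²(G, μ)`. -/
noncomputable def mulOp (h : G →ᵇ ℝ) : Lp ℂ 2 μ →L[ℂ] Lp ℂ 2 μ :=
  LinearMap.mkContinuous
    { toFun := fun ξ => (memLp_mul_of_bounded μ h ξ).toLp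
      map_add' := fun ξ η => by
        rw [← MemLp.toLp_add, MemLp.toLp_eq_toLp_iff]
        filter_upwards [Lp.coeFn_add ξ η] with t ht
        rw [ht, Pi.add_apply, Pi.add_apply, mul_add]
      map_smul' := fun c ξ => by
        rw [RingHom.id_apply, ← MemLp.toLp_const_smul, MemLp.toLp_eq_toLp_iff]
        filter_upwards [Lp.coeFn_smul c ξ] with t ht
        rw [ht, Pi.smul_apply, Pi.smul_apply, mul_smul_comm] }
    ‖h‖
    fun ξ => by
      refine Lp.norm_le_mul_norm_of_ae_le_mul ?_
      filter_upwards [(memLp_mul_of_bounded μ h ξ).coeFn_toLp] with t ht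
      change ‖((memLp_mul_of_bounded μ h ξ).toLp) t‖ ≤ _
      rw [ht, norm_mul, Complex.norm_real]
      exact mul_le_mul_of_nonneg_right (h.norm_coe_le_norm t) (norm_nonneg _)

theorem mulOp_ae (h : G →ᵇ ℝ) (ξ : Lp ℂ 2 μ) :
    mulOp μ h ξ =ᵐ[μ] fun t => (h t : ℂ) * ξ t :=
  (memLp_mul_of_bounded μ h ξ).coeFn_toLp

theorem norm_mulOp_le (h : G →ᵇ ℝ) : ‖mulOp μ h‖ ≤ ‖h‖ :=
  LinearMap.mkContinuous_norm_le _ (norm_nonneg _) _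

theorem mulOp_add (h k : G →ᵇ ℝ) : mulOp μ (h + k) = mulOp μ h + mulOp μ k := by
  ext1 ξ
  refine Lp.ext ?_
  rw [add_apply]
  filter_upwards [mulOp_ae μ (h + k) ξ, mulOp_ae μ h ξ, mulOp_ae μ k ξ,
    Lp.coeFn_add (mulOp μ h ξ) (mulOp μ k ξ)] with t h1 h2 h3 h4
  rw [h1, h4, Pi.add_apply, h2, h3, BoundedContinuousFunction.add_apply, Complex.ofReal_add,
    add_mul]

theorem mulOp_smul (c : ℝ) (h : G →ᵇ ℝ) : mulOp μ (c • h) = (c : ℂ) • mulOp μ h := by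
  ext1 ξ
  refine Lp.ext ?_
  rw [smul_apply]
  filter_upwards [mulOp_ae μ (c • h) ξ, mulOp_ae μ h ξ,
    Lp.coeFn_smul (c : ℂ) (mulOp μ h ξ)] with t h1 h2 h3
  rw [h1, h3, Pi.smul_apply, h2, BoundedContinuousFunction.smul_apply, smul_eq_mul, smul_eq_mul,
    Complex.ofReal_mul, mul_assoc]

theorem mulOp_one : mulOp μ (BoundedContinuousFunction.const G 1) = 1 := by
  ext1 ξ
  refine Lp.ext ?_
  filter_upwards [mulOp_ae μ (BoundedContinuousFunction.const G 1) ξ] with t h1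
  rw [h1, BoundedContinuousFunction.const_apply, Complex.ofReal_one, one_mul]
  rfl

theorem star_mulOp (h : G →ᵇ ℝ) : star (mulOp μ h) = mulOp μ h := by
  rw [eq_comm, ContinuousLinearMap.star_eq_adjoint, ContinuousLinearMap.eq_adjoint_iff]
  intro ξ η
  rw [L2.inner_def, L2.inner_def]
  refine integral_congr_ae ?_
  filter_upwards [mulOp_ae μ h ξ, mulOp_ae μ h η] with t h1 h2
  rw [h1, h2]
  rw [RCLike.inner_apply, RCLike.inner_apply, map_mul, Complex.conj_ofReal]
  ring

/-- This covariance converts invariance under conjugation by λ(s) into invariance of a mean under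
translation. -/
theorem star_leftRegularL_mul_mulOp_mul (s : G) (h : G →ᵇ ℝ) :
    star (leftRegularL μ s) * mulOp μ h * leftRegularL μ s = mulOp μ (leftTranslate s h) := by
  rw [star_leftRegularL]
  ext1 ξ
  refine Lp.ext ?_
  have hq := (measurePreserving_mul_left μ s).quasiMeasurePreserving
  filter_upwards [leftRegular_ae μ s⁻¹ (mulOp μ h (leftRegular μ s ξ)),
    hq.ae (mulOp_ae μ h (leftRegular μ s ξ)), hq.ae (leftRegular_ae μ s ξ),
    mulOp_ae μ (leftTranslate s h) ξ] with t h1 h2 h3 h4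
  rw [h4]
  change leftRegular μ s⁻¹ (mulOp μ h (leftRegular μ s ξ)) t = _
  rw [h1, inv_inv, h2, h3, inv_mul_cancel_left]
  rfl

end Translations

/-! ### Amenability from asymptotically invariant functionals -/

/-- The values at f lie in the compact interval [-‖f‖, ‖f‖], so limits exist along any ultrafilter
finer than `l`. Linearity, normalisation and the bound pass to the limit, and the asymptotic
invariance becomes exact. -/
theorem isAmenableGroup_of_tendsto {G : Type u} [Group G] [TopologicalSpace G]
    [IsTopologicalGroup G] {ι : Type*} (l : Filter ι) [l.NeBot] (m : ι → (G →ᵇ ℝ) →ₗ[ℝ] ℝ)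
    (hb : ∀ i f, |m i f| ≤ ‖f‖) (h1 : ∀ i, m i (BoundedContinuousFunction.const G 1) = 1)
    (hinv : ∀ s f, Tendsto (fun i => m i (leftTranslate s f) - m i f) l (𝓝 0)) :
    IsAmenableGroup G := by
  let U : Ultrafilter ι := Ultrafilter.of l
  have hU : (U : Filter ι) ≤ l := Ultrafilter.of_le l
  have hlim : ∀ f, ∃ x, Tendsto (fun i => m i f) U (𝓝 x) := fun f => by
    obtain ⟨x, -, hx⟩ := (isCompact_Icc (a := -‖f‖) (b := ‖f‖)).ultrafilter_le_nhds
      (U.map fun i => m i f) (by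
        rw [le_principal_iff]
        exact Filter.mem_map.mpr (Eventually.of_forall fun i => abs_le.mp (hb i f)))
    exact ⟨x, hx⟩
  choose M hM using hlim
  have hneg : ∀ f, |M f| ≤ ‖f‖ := fun f => le_of_tendsto' (hM f).abs fun i => hb i f
  have hM1 : M (BoundedContinuousFunction.const G 1) = 1 :=
    tendsto_nhds_unique (hM _) (by simp only [h1]; exact tendsto_const_nhds)
  let L : (G →ᵇ ℝ) →ₗ[ℝ] ℝ :=
    { toFun := M
      map_add' := fun f g => tendsto_nhds_unique (hM _)
        (((hM f).add (hM g)).congr fun i => (map_add (m i) f g).symm)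
      map_smul' := fun c f => tendsto_nhds_unique (hM _)
        (((hM f).const_mul c).congr fun i => (map_smul (m i) c f).symm) }
  refine ⟨L, hM1, fun f hf => ?_, fun s f => ?_⟩
  -- Positivity comes from contractivity: for f ≥ 0 the function ‖f‖ - f has norm at most ‖f‖, so
  -- ‖f‖ - L f ≤ ‖f‖.
  · have h2 : ‖‖f‖ • BoundedContinuousFunction.const G (1 : ℝ) - f‖ ≤ ‖f‖ := by
      refine (BoundedContinuousFunction.norm_le (norm_nonneg f)).mpr fun t => ?_
      have h3 := (le_abs_self _).trans (f.norm_coe_le_norm t)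
      rw [BoundedContinuousFunction.sub_apply, BoundedContinuousFunction.smul_apply,
        BoundedContinuousFunction.const_apply, smul_eq_mul, mul_one, Real.norm_eq_abs, abs_le]
      have := hf t
      constructor <;> linarith
    have h4 := (hneg _).trans h2
    change |L _| ≤ _ at h4
    rw [map_sub, map_smul, smul_eq_mul, show L (BoundedContinuousFunction.const G 1) = 1 from hM1,
      mul_one] at h4
    linarith [(abs_le.mp h4).2]
  · have h2 := tendsto_nhds_unique ((hM (leftTranslate s f)).sub (hM f)) ((hinv s f).mono_left hU)
    exact sub_eq_zero.mp h2

/-! ### States on the operators that dominate a bimodule over a nuclear C*-algebra -/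

/-- The star homomorphism between opposite algebras. -/
def NonUnitalStarAlgHom.opHom {R A B : Type*} [CommSemiring R] [NonUnitalSemiring A]
    [NonUnitalSemiring B] [Module R A] [Module R B] [Star A] [Star B] (f : A →⋆ₙₐ[R] B) :
    Aᵐᵒᵖ →⋆ₙₐ[R] Bᵐᵒᵖ where
  toFun a := op (f a.unop)
  map_smul' c a := congrArg op (map_smul f c a.unop)
  map_zero' := congrArg op (map_zero f)
  map_add' a b := congrArg op (map_add f a.unop b.unop)
  map_mul' a b := congrArg op (map_mul f b.unop a.unop)
  map_star' a := congrArg op (map_star f a.unop)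

section NuclearState

variable {A : Type u} [NonUnitalCStarAlgebra A] {E : Type w} [NormedAddCommGroup E]
  [InnerProductSpace ℂ E] [CompleteSpace E] {j : A →⋆ₙₐ[ℂ] (E →L[ℂ] E)}

/-- Let `A` be a nuclear C*-algebra of operators on `E`, and let `K` carry commuting unital
representations of `B(E)` and its opposite whose product is faithful on `A ⊗ Aᵐᵒᵖ`. For every unit
vector `ξ` in a bimodule over `A` there is a state of `B(E)` that is almost invariant under
conjugation by those unitary multipliers `U` for which `U · ξ · U*` is close to `ξ`. -/
theorem IsNuclear.exists_almost_invariant_state_of_injective (hA : IsNuclear A)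
    {K : Type*} [NormedAddCommGroup K] [InnerProductSpace ℂ K] [CompleteSpace K]
    (L : (E →L[ℂ] E) →⋆ₙₐ[ℂ] (K →L[ℂ] K)) (R : (E →L[ℂ] E)ᵐᵒᵖ →⋆ₙₐ[ℂ] (K →L[ℂ] K))
    (hLR : ∀ S T, L S * R T = R T * L S) (hL1 : L 1 = 1) (hR1 : R 1 = 1)
    (hinj : Function.Injective (pairMap (L.comp j) (R.comp j.opHom)))
    {H : Type v} [NormedAddCommGroup H] [InnerProductSpace ℂ H] [CompleteSpace H]
    {M : HilbertStarBimodule A H} (hM : M.IsNondegenerate) {ξ : H} (hξ : ‖ξ‖ = 1) :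
    ∃ ψ : (E →L[ℂ] E) →ₗ[ℂ] ℂ, (∀ T, ‖ψ T‖ ≤ ‖T‖) ∧ ψ 1 = 1 ∧
      ∀ (x y : 𝓜(ℂ, A)) (U : E →L[ℂ] E), star U * U = 1 →
        (∀ a, j (x.fst a) = U * j a) → (∀ a, j (y.snd a) = j a * star U) →
        ∀ T, star T = T → |(ψ (star U * T * U)).re - (ψ T).re| ≤
          2 * ‖T‖ * √(2 * ‖M.rightMul y (M.leftMul x ξ) - ξ‖ ^ 2) := by
  obtain ⟨φ, hφ, hφ1, hφQ⟩ := HilbertStarBimodule.exists_state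
    (α := L.comp j) (β := R.comp j.opHom) (fun a b => hLR _ _) hA hinj hM hξ
  have hnorm : ∀ T, ‖L T‖ ≤ ‖T‖ := NonUnitalStarAlgHom.norm_apply_le L
  refine ⟨φ.toLinearMap ∘ₗ (L : (E →L[ℂ] E) →ₗ[ℂ] _), fun T => ?_, ?_,
    fun x y U hU hx hy T hT => ?_⟩
  · exact ((φ.le_of_opNorm_le hφ _).trans_eq (one_mul _)).trans (hnorm T)
  · exact (congrArg φ hL1).trans hφ1
  · have hLU : L (star U) * L U = 1 := by rw [← map_mul, hU, hL1]
    have hRU : R (op U) * R (op (star U)) = 1 := by rw [← map_mul, ← op_mul, hU, op_one, hR1]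
    -- This models two-sided multiplication T ↦ U T U*, matching the action ξ ↦ x · ξ · y on the
    -- bimodule.
    set u := L U * R (op (star U)) with hu
    have hstar : star u = R (op U) * L (star U) := by
      rw [hu, star_mul, ← map_star, ← map_star, ← op_star, star_star]
    have huu : star u * u = 1 := by
      rw [hstar, hu, mul_assoc, ← mul_assoc (L (star U)), hLU, one_mul, hRU]
    have hun : ‖u‖ ≤ 1 := by
      have h := CStarRing.norm_star_mul_self (x := u)
      rw [huu] at h
      have h1 : ‖(1 : K →L[ℂ] K)‖ ≤ 1 := ContinuousLinearMap.norm_id_le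
      nlinarith [norm_nonneg u]
    -- The factors from R commute with the range of L and cancel, leaving conjugation by U alone.
    have hconj : star u * L T * u = L (star U * T * U) := by
      have : star u * L T * u = R (op U) * (L (star U) * L T * L U) * R (op (star U)) := by
        rw [hstar, hu]
        simp only [mul_assoc]
      rw [this, ← map_mul, ← map_mul, ← hLR, mul_assoc, hRU, mul_one]
    have h4 := abs_re_conj_sub_le hφ hφ1 (m := L T) hun (by rw [← map_star, hT]) (hnorm T)
    rw [hconj] at h4
    refine h4.trans (mul_le_mul_of_nonneg_left (Real.sqrt_le_sqrt ?_) (by positivity))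
    refine hφQ x y u huu fun a b => ?_
    rw [pairMap_tmul, pairMap_tmul]
    change u * (L (j a) * R (op (j b))) = L (j (x.fst a)) * R (op (j (y.snd b)))
    rw [hx, hy, hu, op_mul, map_mul, map_mul, mul_assoc, ← mul_assoc (R _), ← hLR, mul_assoc,
      mul_assoc]

/-- The product sends a ⊗ b to j(a) tensored with the transpose of j(b), and transposition is
injective, so both legs are faithful. -/
theorem pairMap_tensorLeft_tensorDualRight_injective (hj : Function.Injective j) :
    Function.Injective (pairMap (A := A) (B := Aᵐᵒᵖ)
      (C := HilbertTensor E (StrongDual ℂ E) →L[ℂ] HilbertTensor E (StrongDual ℂ E))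
      ((tensorLeft E (StrongDual ℂ E)).comp j) ((tensorDualRight E).comp j.opHom)) := by
  let σ : Aᵐᵒᵖ →ₗ[ℂ] (StrongDual ℂ E →L[ℂ] StrongDual ℂ E) :=
    { toFun := fun b => precompDual (j b.unop)
      map_add' := fun a b => by
        rw [unop_add, map_add]
        exact map_add (ContinuousLinearMap.compL ℂ E E ℂ).flip _ _
      map_smul' := fun c a => by
        rw [unop_smul, map_smul]
        exact map_smul (ContinuousLinearMap.compL ℂ E E ℂ).flip c _ }
  refine injective_of_apply_tmul_eq_tensorOp (j : A →ₗ[ℂ] (E →L[ℂ] E)) σ hj (fun a b h => ?_) _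
    fun a b => ?_
  · exact unop_injective (hj (precompDual_injective h))
  · rw [pairMap_tmul]
    exact tensorLeft_mul_tensorDualRight _ _

/-- The states of `IsNuclear.exists_almost_invariant_state_of_injective` exist for every faithful
representation of a nuclear C*-algebra. -/
theorem IsNuclear.exists_almost_invariant_state (hA : IsNuclear A) (hj : Function.Injective j)
    {H : Type v} [NormedAddCommGroup H] [InnerProductSpace ℂ H] [CompleteSpace H]
    {M : HilbertStarBimodule A H} (hM : M.IsNondegenerate) {ξ : H} (hξ : ‖ξ‖ = 1) :
    ∃ ψ : (E →L[ℂ] E) →ₗ[ℂ] ℂ, (∀ T, ‖ψ T‖ ≤ ‖T‖) ∧ ψ 1 = 1 ∧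
      ∀ (x y : 𝓜(ℂ, A)) (U : E →L[ℂ] E), star U * U = 1 →
        (∀ a, j (x.fst a) = U * j a) → (∀ a, j (y.snd a) = j a * star U) →
        ∀ T, star T = T → |(ψ (star U * T * U)).re - (ψ T).re| ≤
          2 * ‖T‖ * √(2 * ‖M.rightMul y (M.leftMul x ξ) - ξ‖ ^ 2) :=
  hA.exists_almost_invariant_state_of_injective (K := HilbertTensor E (StrongDual ℂ E))
    (tensorLeft E (StrongDual ℂ E)) (tensorDualRight E)
    (fun S T => (tensorLeft_mul_tensorDualRight S T).trans
      (tensorDualRight_mul_tensorLeft S T).symm)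
    tensorOp_one tensorOp_one (pairMap_tensorLeft_tensorDualRight_injective hj) hM hξ

end NuclearState

/-! ### Amenability of G from almost central nets over C*_r(G) -/

section ReducedGroupCStarAlgebra

set_option linter.unusedSectionVars false

variable {G : Type u} [Group G] [TopologicalSpace G] [IsTopologicalGroup G]
  [LocallyCompactSpace G] [T2Space G] [MeasurableSpace G] [BorelSpace G]
  (μ : Measure G) [μ.IsHaarMeasure] [μ.Regular]

/-- The restriction of a functional on the operators to the multiplication operators. -/
noncomputable def restrictMulOp (ψ : (Lp ℂ 2 μ →L[ℂ] Lp ℂ 2 μ) →ₗ[ℂ] ℂ) : (G →ᵇ ℝ) →ₗ[ℝ] ℝ where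
  toFun h := (ψ (mulOp μ h)).re
  map_add' h k := by rw [mulOp_add, map_add, Complex.add_re]
  map_smul' c h := by
    rw [mulOp_smul, map_smul, smul_eq_mul, Complex.re_ofReal_mul]
    rfl

/-- The inclusion of `C*_r(G)` in the operators on `L²(G, μ)`. -/
noncomputable def reducedInclusion :
    reducedGroupCStarAlgebra μ →⋆ₙₐ[ℂ] (Lp ℂ 2 μ →L[ℂ] Lp ℂ 2 μ) :=
  NonUnitalStarSubalgebraClass.subtype (reducedGroupCStarAlgebra μ)

theorem reducedInclusion_injective : Function.Injective (reducedInclusion μ) :=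
  Subtype.val_injective

theorem translationMultiplier_snd_snd (s : G) (a : reducedGroupCStarAlgebra μ) :
    (translationMultiplier μ s⁻¹).snd ((translationMultiplier μ s).snd a) = a := by
  refine Subtype.ext ?_
  rw [coe_translationMultiplier_snd, coe_translationMultiplier_snd, mul_assoc,
    ← leftRegularL_mul, mul_inv_cancel, leftRegularL_one, mul_one]

/-- An almost central net is asymptotically invariant under conjugation by group elements. -/
theorem tendsto_conj_of_isAlmostCentral
    {H : Type v} [NormedAddCommGroup H] [InnerProductSpace ℂ H] [CompleteSpace H]
    {M : HilbertStarBimodule (reducedGroupCStarAlgebra μ) H} (hM : M.IsNondegenerate)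
    {ι : Type w} [Preorder ι] {ξ : ι → H} (hc : M.IsAlmostCentral ξ) (s : G) :
    Tendsto (fun i => M.rightMul (translationMultiplier μ s⁻¹)
      (M.leftMul (translationMultiplier μ s) (ξ i)) - ξ i) atTop (𝓝 0) := by
  set x := translationMultiplier μ s
  set y := translationMultiplier μ s⁻¹
  have h0 : Tendsto (fun i => M.leftMul x (ξ i) - M.rightMul x (ξ i)) atTop (𝓝 0) := by
    rw [Metric.tendsto_nhds]
    intro ε hε
    -- A singleton is compact in every topology, so no finer information about the strict topology
    -- is needed.
    filter_upwards [hc {x} (@isCompact_singleton _ (strictTopology _) x) (ε / 2) (half_pos hε)]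
      with i hi
    rw [dist_zero_right]
    exact (hi x rfl).trans_lt (half_lt_self hε)
  -- Acting on the right by λ(s⁻¹) turns x · ξ - ξ · x into x · ξ · x⁻¹ - ξ.
  have := ((M.rightMul y).continuous.tendsto _).comp h0
  rw [map_zero] at this
  refine this.congr fun i => ?_
  rw [Function.comp_apply, map_sub,
    HilbertStarBimodule.rightMul_rightMul_of_inv hM (translationMultiplier_snd_snd μ s)]

/-- If `C*_r(G)` is nuclear and some bimodule over it has an almost central net of unit vectors,
then `G` is amenable. -/
theorem isAmenableGroup_of_isAlmostCentral (hnuc : IsNuclear (reducedGroupCStarAlgebra μ))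
    {H : Type v} [NormedAddCommGroup H] [InnerProductSpace ℂ H] [CompleteSpace H]
    {M : HilbertStarBimodule (reducedGroupCStarAlgebra μ) H} (hM : M.IsNondegenerate)
    {ι : Type w} [Preorder ι] [IsDirectedOrder ι] [Nonempty ι] {ξ : ι → H}
    (hξ : ∀ i, ‖ξ i‖ = 1) (hc : M.IsAlmostCentral ξ) : IsAmenableGroup G := by
  choose ψ hψ hψ1 hψQ using fun i =>
    hnuc.exists_almost_invariant_state (reducedInclusion_injective μ) hM (hξ i)
  refine isAmenableGroup_of_tendsto atTop (fun i => restrictMulOp μ (ψ i)) (fun i f => ?_)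
    (fun i => ?_) fun s f => ?_
  · exact (Complex.abs_re_le_norm _).trans ((hψ i _).trans (norm_mulOp_le μ f))
  · change (ψ i (mulOp μ _)).re = 1
    rw [mulOp_one, hψ1, Complex.one_re]
  · have h2 := ((tendsto_conj_of_isAlmostCentral μ hM hc s).norm.pow 2).const_mul 2
    have h3 := ((Real.continuous_sqrt.tendsto _).comp h2).const_mul (2 * ‖mulOp μ f‖)
    rw [norm_zero, zero_pow two_ne_zero, mul_zero, Real.sqrt_zero, mul_zero] at h3
    refine squeeze_zero_norm (fun i => ?_) h3
    have h4 := hψQ i (translationMultiplier μ s) (translationMultiplier μ s⁻¹) (leftRegularL μ s)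
      (by rw [star_leftRegularL, ← leftRegularL_mul, inv_mul_cancel, leftRegularL_one])
      (fun _ => rfl) (fun _ => by rw [star_leftRegularL]; rfl) (mulOp μ f) (star_mulOp μ f)
    rwa [star_leftRegularL_mul_mulOp_mul] at h4

end ReducedGroupCStarAlgebra

theorem theorem1p3 {G : Type u} [Group G] [TopologicalSpace G] [IsTopologicalGroup G]
    [LocallyCompactSpace G] [T2Space G] [MeasurableSpace G] [BorelSpace G]
    (μ : Measure G) [μ.IsHaarMeasure] [μ.Regular]
    (hnuc : IsNuclear (reducedGroupCStarAlgebra μ)) (hG : ¬ IsAmenableGroup G) :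
    HasStrongPropertyT.{u, v, w} (reducedGroupCStarAlgebra μ) ∧
    ∀ (H : Type v) [NormedAddCommGroup H] [InnerProductSpace ℂ H] [CompleteSpace H]
      (M : HilbertStarBimodule (reducedGroupCStarAlgebra μ) H), M.IsNondegenerate →
      ¬ ∃ (ι : Type w) (_ : Preorder ι) (_ : IsDirectedOrder ι) (_ : Nonempty ι) (ξ : ι → H),
        (∀ i, ‖ξ i‖ = 1) ∧ M.IsAlmostCentral ξ := by
  refine ⟨fun H _ _ _ M hM ι _ _ _ ξ hξ hc =>
    absurd (isAmenableGroup_of_isAlmostCentral μ hnuc hM hξ hc) hG, ?_⟩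
  rintro H _ _ _ M hM ⟨ι, _, _, _, ξ, hξ, hc⟩
  exact hG (isAmenableGroup_of_isAlmostCentral μ hnuc hM hξ hc)
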